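/- **Setting.** Let $n\ge 2$, $G=SL(n,\mathbb C)$, $K=SU(n)$, $Z=G/K$, $u=K\in Z$, and let $\mathfrak p$ be the real vector space of hermitian $n\times n$ matrices of trace $0$, identified with $T_uZ$. Endow $Z$ with the $G$-invariant Riemannian metric which on $T_uZ=\mathfrak p$ is the Killing form $B(X,Y)=4n\,\mathrm{Re}\,\mathrm{Tr}(XY)$, and let $\mathrm{dist}$ be its distance. The geodesics of $Z$ are the curves $t\mapsto g\exp(tX)u$ with $g\in G$, $X\in\mathfrak p$. A *ray* is a unit speed half-geodesic $[0,\infty)\to Z$; two rays are *asymptotic* if their distance is bounded, and $Z(\infty)$ is the set of asymptoty classes of rays, on which $G$ acts. For a subspace $0\ne W\subsetneq\mathbb C^n$ let $z_W\in Z(\infty)$ be the point whose stabilizer in $G$ is $\{g\in G: gW=W\}$; for $z\in Z$ let $[z,z_W]$ be the ray starting in $z$ in the class $z_W$. If $\mathbb C^n=W\oplus W'$ with $0<r=\dim W<n$, and $h$, $h'$ are hermitian metrics (positive definite hermitian forms) on $W$, $W'$, the geodesic *associated to* $(\{h\},\{h'\})$ (classes up to positive multiples) is $$t\mapsto g\,\exp\bigl(t\,\mathrm{diag}(\underbrace{\rho,\dots,\rho}_{r},\sigma,\dots,\sigma)\bigr)u,\qquad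 \rho=\sqrt{\tfrac{n-r}{4rn^2}},\quad \sigma=-\tfrac{r}{n-r}\rho,$$ where $g\in G$ is such that $ge_1,\dots,ge_r$ is an orthonormal basis of a positive multiple of $h$ and $ge_{r+1},\dots,ge_n$ is an orthonormal basis of a positive multiple of $h'$. Up to reparametrization it depends only on $(\{h\},\{h'\})$, and it connects $z_W$ and $z_{W'}$. For a hermitian metric $h$ on $\mathbb C^n$ and a subspace $C$ of codimension $1$, let $z_1,\dots,z_n$ be an orthonormal basis of the dual space (for the metric dual to $h$) with $C=\ker z_1$, and let $\Lambda_C=\log(|z_1|^2+\dots+|z_n|^2)-\log|z_1|^2$ on $\mathbb P^{n-1}(\mathbb C)\setminus\mathbb P(C)$ (the Levine form of $\mathbb P(C)$). For points $a,b$ and hyperplanes $H_C=\mathbb P(C)$, $H_D=\mathbb P(D)$ such that $a-b$ and $H_C-H_D$ have disjoint supports, the Archimedean intersection number is $$\langle a-b,H_C-H_D\rangle=(\Lambda_C-\Lambda_D)(a)-(\Lambda_C-\Lambda_D)(b);$$ it does not depend on $h$. **Corollary 5.2.** Let $a\neq b$ be points of $\mathbb P^{n-1}(\mathbb C)$ and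 let $H_C\ne H_D$ be hyperplanes such that the cycles $a-b$ and $H_C-H_D$ have disjoint supports. Let $A,B\subset\mathbb C^n$ be the lines corresponding to $a,b$, let $C,D\subset\mathbb C^n$ be the subspaces of codimension $1$ corresponding to $H_C,H_D$, and let $\langle A,B\rangle$ be the span of $A$ and $B$. If $\langle A,B\rangle\cap C=\langle A,B\rangle\cap D$, then $\langle a-b,H_C-H_D\rangle=0$. Otherwise, let $h_0$, $h_1$, $h_2$ be any hermitian metrics on $C\cap D$, $\langle A,B\rangle\cap C$, $\langle A,B\rangle\cap D$. Then $C=(C\cap D)\oplus(\langle A,B\rangle\cap C)$, so that the orthogonal sum $h_0\oplus h_1$ is a hermitian metric on $C$, and there is a geodesic $\gamma$ associated to $(\{h_0\oplus h_1\},\{h_2\})$, connecting the boundary points of $C$ and $\langle A,B\rangle\cap D$; orient it from $C$ to $\langle A,B\rangle\cap D$. There is a unique point $a*\gamma$ on $\gamma$ such that the ray $[a*\gamma,z_A]$ meets $\gamma$ at a right angle, and likewise a unique point $b*\gamma$ on $\gamma$ for $z_B$, and $$\langle a-b,H_C-H_D\rangle=\frac1{\sqrt{n-1}}\;\mathrm{distor}_\gamma(a*\gamma,b*\gamma),$$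 where $\mathrm{distor}_\gamma(x,y)$ is the oriented distance along $\gamma$, i.e. $\mathrm{dist}(x,y)$ if $x$ appears before $y$ on $\gamma$, and $-\mathrm{dist}(x,y)$ otherwise. -/

import Mathlib

open scoped LinearAlgebra.Projectivization Matrix NNReal ENNReal

namespace ArchInt

/-! ### The symmetric space `Z = SL(n,ℂ) / SU(n)` -/

/-- Complex `n × n` matrices. -/
abbrev Mat (n : ℕ) := Matrix (Fin n) (Fin n) ℂ

/-- The group `G = SL(n, ℂ)`. -/
abbrev G (n : ℕ) := Matrix.SpecialLinearGroup (Fin n) ℂ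

/-- The maximal compact subgroup `K = SU(n)` of `G`. -/
def K (n : ℕ) : Subgroup (G n) where
  carrier := {g | (g : Mat n) * (g : Mat n)ᴴ = 1}
  one_mem' := by simp
  mul_mem' := by
    intro a b ha hb
    simp only [Set.mem_ofPred_eq, Matrix.SpecialLinearGroup.coe_mul,
      Matrix.conjTranspose_mul] at *
    rw [Matrix.mul_assoc, ← Matrix.mul_assoc (b : Mat n), hb,
      Matrix.one_mul, ha]
  inv_mem' := by
    intro a ha
    simp only [Set.mem_ofPred_eq] at *
    have h1 : ((a⁻¹ : G n) : Mat n) * a = 1 := by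
      rw [← Matrix.SpecialLinearGroup.coe_mul]; simp
    have h2 : ((a⁻¹ : G n) : Mat n)
        = (a : Mat n)ᴴ := by
      calc ((a⁻¹ : G n) : Mat n)
          = ((a⁻¹ : G n) : Mat n) * (a * (a : Mat n)ᴴ) := by
            rw [ha, Matrix.mul_one]
        _ = _ := by rw [← Matrix.mul_assoc, h1, Matrix.one_mul]
    rw [h2, Matrix.conjTranspose_conjTranspose, ← h2, h1]

/-- The symmetric space `Z = G / K`, with the left action of `G`. -/
abbrev Z (n : ℕ) := G n ⧸ K n

/-- The Killing form `B(X, Y) = Tr(ad X ad Y) = 4 n Re Tr(X Y)` of the real Lie algebra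
`sl(n, ℂ)`. -/
noncomputable def killing {n : ℕ} (X Y : Mat n) : ℝ :=
  4 * n * (X * Y).trace.re

/-- The `(-1)`-eigenspace `p` of the Cartan involution `X ↦ -Xᴴ` on `sl(n, ℂ)`: the hermitian
matrices of trace zero.  It is the tangent space of `Z` at the base point. -/
def pSpace (n : ℕ) : Submodule ℝ (Mat n) where
  carrier := {X | X.IsHermitian ∧ X.trace = 0}
  zero_mem' := by simp
  add_mem' := by
    rintro X Y ⟨hX, hX'⟩ ⟨hY, hY'⟩
    exact ⟨hX.add hY, by simp [hX', hY']⟩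
  smul_mem' := by
    rintro c X ⟨hX, hX'⟩
    refine ⟨?_, by simp [hX']⟩
    change (c • X)ᴴ = c • X
    rw [Matrix.conjTranspose_smul, hX.eq]; simp

/-- The projection of a matrix to its hermitian part.  On `sl(n, ℂ) = p ⊕ k` this is the
projection to `p`. -/
noncomputable def pPart {n : ℕ} (X : Mat n) : Mat n :=
  (1 / 2 : ℂ) • (X + Xᴴ)

/-- The velocity of a curve in `G` (entrywise derivative). -/
noncomputable def velocity {n : ℕ} (c : ℝ → G n) (t : ℝ) : Mat n :=
  Matrix.of fun i j => deriv (fun s => (c s : Mat n) i j) t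

/-- The tangent vector at time `t` of the curve `s ↦ c(s) K` in `Z`, translated back to the base
point by `c(t)⁻¹`: it is the `p`-part of `c(t)⁻¹ c'(t)`. -/
noncomputable def tangent {n : ℕ} (c : ℝ → G n) (t : ℝ) : Mat n :=
  pPart ((((c t)⁻¹ : G n) : Mat n) * velocity c t)

/-- The speed at time `t` of the curve `s ↦ c(s) K` in `Z`, for the `G`-invariant Riemannian metric
on `Z` which is the Killing form on `p`, the tangent space at the base point. -/
noncomputable def speed {n : ℕ} (c : ℝ → G n) (t : ℝ) : ℝ :=
  √(killing (tangent c t) (tangent c t))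

/-- A continuously differentiable curve in `Z` from `x` to `y`, given by a lift to `G`
parametrized so that it runs from time `0` to time `1`. -/
structure Curve {n : ℕ} (x y : Z n) where
  toFun : ℝ → G n
  contDiff : ∀ i j, ContDiff ℝ 1 (fun s => (toFun s : Mat n) i j)
  start_eq : (QuotientGroup.mk (toFun 0) : Z n) = x
  end_eq : (QuotientGroup.mk (toFun 1) : Z n) = y

/-- The Riemannian length of a curve. -/
noncomputable def Curve.length {n : ℕ} {x y : Z n} (c : Curve x y) : ℝ :=
  ∫ t in (0 : ℝ)..1, speed c.toFun t

/-- The Riemannian distance of `Z` as an extended number: the infimum of the lengths of curves. -/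
noncomputable def zEDist {n : ℕ} (x y : Z n) : ℝ≥0∞ := ⨅ c : Curve x y, ENNReal.ofReal c.length

/-- The Riemannian distance of `Z`. -/
noncomputable def zDist {n : ℕ} (x y : Z n) : ℝ := (zEDist x y).toReal

section DistLemmas

variable {n : ℕ}

theorem velocity_hasDerivAt {c : ℝ → G n}
    (hc : ∀ i j, ContDiff ℝ 1 (fun s => (c s : Mat n) i j)) (t : ℝ) (i j) :
    HasDerivAt (fun s => (c s : Mat n) i j) (velocity c t i j) t :=
  (((hc i j).differentiable (by norm_num)) t).hasDerivAt

theorem velocity_eq {c : ℝ → G n} {t : ℝ} {V : Mat n}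
    (h : ∀ i j, HasDerivAt (fun s => (c s : Mat n) i j) (V i j) t) :
    velocity c t = V := by
  ext i j
  exact (h i j).deriv

theorem speed_congr {c d : ℝ → G n} {t : ℝ} (h : c =ᶠ[nhds t] d) : speed c t = speed d t := by
  have h1 : velocity c t = velocity d t := by
    ext i j
    exact Filter.EventuallyEq.deriv_eq (h.fun_comp fun g => (g : Mat n) i j)
  simp only [speed, tangent]
  rw [h1, h.eq_of_nhds]

theorem killing_smul (a : ℝ) (X : Mat n) :
    killing ((a : ℂ) • X) ((a : ℂ) • X) = a ^ 2 * killing X X := by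
  have : ((a : ℂ) • X) * ((a : ℂ) • X) = ((a ^ 2 : ℝ) : ℂ) • (X * X) := by
    rw [Matrix.smul_mul, Matrix.mul_smul, smul_smul]
    norm_cast
    rw [sq]
  rw [killing, this, Matrix.trace_smul, smul_eq_mul, Complex.re_ofReal_mul, killing]
  ring

theorem pPart_smul (a : ℝ) (X : Mat n) :
    pPart ((a : ℂ) • X) = (a : ℂ) • pPart X := by
  have : ((a : ℂ) • X)ᴴ = (a : ℂ) • Xᴴ := by
    rw [Matrix.conjTranspose_smul]; simp
  rw [pPart, this, ← smul_add, smul_comm, pPart]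

theorem contDiff_mul {c d : ℝ → G n}
    (hc : ∀ i j, ContDiff ℝ 1 (fun s => (c s : Mat n) i j))
    (hd : ∀ i j, ContDiff ℝ 1 (fun s => (d s : Mat n) i j)) :
    ∀ i j, ContDiff ℝ 1 (fun s => ((c s * d s : G n) : Mat n) i j) := by
  intro i j
  simp only [Matrix.SpecialLinearGroup.coe_mul, Matrix.mul_apply]
  exact ContDiff.sum fun k _ => (hc i k).mul (hd k j)

theorem speed_left (g : G n) {c : ℝ → G n}
    (hc : ∀ i j, ContDiff ℝ 1 (fun s => (c s : Mat n) i j)) (t : ℝ) :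
    speed (fun s => g * c s) t = speed c t := by
  have h : velocity (fun s => g * c s) t = (g : Mat n) * velocity c t := by
    apply velocity_eq
    intro i j
    simp only [Matrix.SpecialLinearGroup.coe_mul, Matrix.mul_apply]
    exact HasDerivAt.fun_sum fun k _ => (velocity_hasDerivAt hc t k j).const_mul _
  have h2 : (((g * c t)⁻¹ : G n) : Mat n) * velocity (fun s => g * c s) t
      = (((c t)⁻¹ : G n) : Mat n) * velocity c t := by
    rw [h, ← Matrix.mul_assoc, ← Matrix.SpecialLinearGroup.coe_mul]
    simp
  simp only [speed, tangent]
  rw [h2]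

theorem speed_right {k : G n} (hk : k ∈ K n) {c : ℝ → G n}
    (hc : ∀ i j, ContDiff ℝ 1 (fun s => (c s : Mat n) i j)) (t : ℝ) :
    speed (fun s => c s * k) t = speed c t := by
  have h : velocity (fun s => c s * k) t = velocity c t * (k : Mat n) := by
    apply velocity_eq
    intro i j
    simp only [Matrix.SpecialLinearGroup.coe_mul, Matrix.mul_apply]
    exact HasDerivAt.fun_sum fun l _ => (velocity_hasDerivAt hc t i l).mul_const _
  have hk1 : (k : Mat n) * (k : Mat n)ᴴ = 1 := hk
  have hk2 : (k : Mat n)ᴴ * (k : Mat n) = 1 :=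
    mul_eq_one_comm.mp hk1
  have hki : ((k⁻¹ : G n) : Mat n) = (k : Mat n)ᴴ := by
    have h1 : ((k⁻¹ : G n) : Mat n) * k = 1 := by
      rw [← Matrix.SpecialLinearGroup.coe_mul]; simp
    calc ((k⁻¹ : G n) : Mat n)
        = ((k⁻¹ : G n) : Mat n) * (k * (k : Mat n)ᴴ) := by
          rw [hk1, Matrix.mul_one]
      _ = _ := by rw [← Matrix.mul_assoc, h1, Matrix.one_mul]
  have h2 : tangent (fun s => c s * k) t
      = (k : Mat n)ᴴ * tangent c t * k := by
    simp only [tangent]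
    rw [h, mul_inv_rev, Matrix.SpecialLinearGroup.coe_mul, hki]
    simp only [pPart, Matrix.conjTranspose_mul, Matrix.conjTranspose_conjTranspose,
      Matrix.mul_smul, Matrix.smul_mul, Matrix.mul_add, Matrix.add_mul, Matrix.mul_assoc]
  have h3 : ∀ X : Mat n,
      killing ((k : Mat n)ᴴ * X * (k : Mat n)) ((k : Mat n)ᴴ * X * (k : Mat n))
        = killing X X := by
    intro X
    have : ((k : Mat n)ᴴ * X * (k : Mat n)) * ((k : Mat n)ᴴ * X * (k : Mat n))
        = (k : Mat n)ᴴ * (X * X * (k : Mat n)) := by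
      rw [Matrix.mul_assoc _ (k : Mat n), ← Matrix.mul_assoc
        (k : Mat n), ← Matrix.mul_assoc (k : Mat n),
        hk1, Matrix.one_mul]
      simp only [Matrix.mul_assoc]
    rw [killing, this, Matrix.trace_mul_comm, Matrix.mul_assoc, hk1, Matrix.mul_one, killing]
  simp only [speed]
  rw [h2, h3]

theorem speed_comp {c : ℝ → G n}
    (hc : ∀ i j, ContDiff ℝ 1 (fun s => (c s : Mat n) i j))
    {f : ℝ → ℝ} {f' t : ℝ} (hf : HasDerivAt f f' t) :
    speed (fun s => c (f s)) t = |f'| * speed c (f t) := by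
  have h : velocity (fun s => c (f s)) t = (f' : ℂ) • velocity c (f t) := by
    apply velocity_eq
    intro i j
    have := (velocity_hasDerivAt hc (f t) i j).scomp t hf
    simpa [Function.comp_def] using this
  rw [speed, tangent, h, Matrix.mul_smul, pPart_smul, killing_smul, Real.sqrt_mul (sq_nonneg _),
    Real.sqrt_sq_eq_abs]
  rfl

theorem speed_continuous {c : ℝ → G n}
    (hc : ∀ i j, ContDiff ℝ 1 (fun s => (c s : Mat n) i j)) :
    Continuous (speed c) := by
  have h1 : Continuous fun t => (c t : Mat n) :=
    continuous_pi fun i => continuous_pi fun j => (hc i j).continuous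
  have h2 : Continuous (velocity c) :=
    continuous_pi fun i => continuous_pi fun j => (hc i j).continuous_deriv (le_refl _)
  have h3 : Continuous fun t => tangent c t := by
    have h4 : Continuous fun t => (((c t)⁻¹ : G n) : Mat n) := by
      simp only [Matrix.SpecialLinearGroup.coe_inv]
      exact h1.matrix_adjugate
    have h5 := h4.matrix_mul h2
    exact (h5.add h5.matrix_conjTranspose).const_smul (1 / 2 : ℂ)
  unfold speed killing
  exact ((Complex.continuous_re.comp (h3.matrix_mul h3).matrix_trace).const_mul _).sqrt

theorem zEDist_self (x : Z n) : zEDist x x = 0 := by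
  obtain ⟨g, rfl⟩ := QuotientGroup.mk_surjective x
  let c : Curve (QuotientGroup.mk g : Z n) (QuotientGroup.mk g) :=
    ⟨fun _ => g, fun i j => contDiff_const, rfl, rfl⟩
  have hs : ∀ t, speed c.toFun t = 0 := by
    intro t
    have : velocity c.toFun t = 0 := velocity_eq (V := 0) (fun i j => hasDerivAt_const t ((g : Mat n) i j))
    simp [speed, tangent, this, pPart, killing]
  refine le_antisymm ((iInf_le _ c).trans ?_) zero_le
  simp [Curve.length, hs]

theorem zEDist_le_symm (x y : Z n) : zEDist x y ≤ zEDist y x := by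
  refine le_iInf fun c => ?_
  let d : Curve x y :=
    ⟨fun s => c.toFun (1 - s),
      fun i j => (c.contDiff i j).comp (contDiff_const.sub contDiff_id),
      by simpa using c.end_eq, by simpa using c.start_eq⟩
  have hs : ∀ t, speed d.toFun t = speed c.toFun (1 - t) := by
    intro t
    have := speed_comp c.contDiff (f := fun s => 1 - s) (t := t) ((hasDerivAt_id t).const_sub 1)
    simpa [d] using this
  have hl : d.length = c.length := by
    simp only [Curve.length, hs]
    simp [intervalIntegral.integral_comp_sub_left (fun t => speed c.toFun t) 1]
  exact (iInf_le _ d).trans_eq (by rw [hl])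

theorem zEDist_comm (x y : Z n) : zEDist x y = zEDist y x :=
  le_antisymm (zEDist_le_symm x y) (zEDist_le_symm y x)

theorem zEDist_smul_le (g : G n) (x y : Z n) : zEDist (g • x) (g • y) ≤ zEDist x y := by
  refine le_iInf fun c => ?_
  let d : Curve (g • x) (g • y) :=
    ⟨fun s => g * c.toFun s, contDiff_mul (fun _ _ => contDiff_const) c.contDiff,
      (congrArg (g • ·) c.start_eq), (congrArg (g • ·) c.end_eq)⟩
  have hl : d.length = c.length := by
    simp only [Curve.length]
    exact intervalIntegral.integral_congr fun t _ => speed_left g c.contDiff t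
  exact (iInf_le _ d).trans_eq (by rw [hl])

theorem zEDist_smul (g : G n) (x y : Z n) : zEDist (g • x) (g • y) = zEDist x y := by
  refine le_antisymm (zEDist_smul_le g x y) ?_
  simpa using zEDist_smul_le g⁻¹ (g • x) (g • y)

theorem contDiff_reparam {c : ℝ → G n}
    (hc : ∀ i j, ContDiff ℝ 1 (fun s => (c s : Mat n) i j)) (b : ℝ) (i j : Fin n) :
    ContDiff ℝ 1 (fun s => (c (Real.smoothTransition (2 * s - b)) : Mat n) i j) :=
  (hc i j).comp ((Real.smoothTransition.contDiff (n := 1)).comp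
    ((contDiff_const.mul contDiff_id).sub contDiff_const))

theorem length_reparam {c : ℝ → G n}
    (hc : ∀ i j, ContDiff ℝ 1 (fun s => (c s : Mat n) i j)) (b : ℝ) :
    ∫ t in (b / 2)..(b / 2 + 1 / 2), speed (fun s => c (Real.smoothTransition (2 * s - b))) t
      = ∫ t in (0 : ℝ)..1, speed c t := by
  set f : ℝ → ℝ := fun s => Real.smoothTransition (2 * s - b) with hf
  have hfc : ContDiff ℝ 1 f :=
    (Real.smoothTransition.contDiff (n := 1)).comp
      ((contDiff_const.mul contDiff_id).sub contDiff_const)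
  have hfd : ∀ t, HasDerivAt f (deriv f t) t := fun t =>
    ((hfc.differentiable (by norm_num)) t).hasDerivAt
  have hmono : Monotone f := fun s t hst =>
    Real.smoothTransition.monotone (by linarith)
  have hpos : ∀ t, 0 ≤ deriv f t := fun t => hmono.deriv_nonneg
  have h1 : ∀ t, speed (fun s => c (f s)) t = (speed c ∘ f) t * deriv f t := by
    intro t
    rw [speed_comp hc (hfd t), abs_of_nonneg (hpos t), mul_comm]; rfl
  have h0 : f (b / 2) = 0 := Real.smoothTransition.zero_of_nonpos (by linarith)
  have h2 : f (b / 2 + 1 / 2) = 1 := Real.smoothTransition.one_of_one_le (by linarith)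
  calc ∫ t in (b / 2)..(b / 2 + 1 / 2), speed (fun s => c (f s)) t
      = ∫ t in (b / 2)..(b / 2 + 1 / 2), (speed c ∘ f) t * deriv f t :=
        intervalIntegral.integral_congr fun t _ => h1 t
    _ = ∫ t in (f (b / 2))..(f (b / 2 + 1 / 2)), speed c t :=
        intervalIntegral.integral_comp_mul_deriv (fun t _ => hfd t)
          (hfc.continuous_deriv (le_refl _)).continuousOn (speed_continuous hc)
    _ = _ := by rw [h0, h2]

theorem zEDist_le_add {x y z : Z n} (c : Curve x y) (d : Curve y z) :
    zEDist x z ≤ ENNReal.ofReal c.length + ENNReal.ofReal d.length := by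
  have hk : (c.toFun 1)⁻¹ * d.toFun 0 ∈ K n :=
    QuotientGroup.eq.mp (c.end_eq.trans d.start_eq.symm)
  set k : G n := (c.toFun 1)⁻¹ * d.toFun 0 with hkdef
  -- Reparametrize both curves to be constant near the junction, and glue by multiplication.
  let c' : ℝ → G n := fun s => c.toFun (Real.smoothTransition (2 * s - 0))
  let d' : ℝ → G n := fun s => d.toFun (Real.smoothTransition (2 * s - 1))
  have hc' : ∀ i j, ContDiff ℝ 1 (fun s => (c' s : Mat n) i j) := contDiff_reparam c.contDiff 0
  have hd' : ∀ i j, ContDiff ℝ 1 (fun s => (d' s : Mat n) i j) := contDiff_reparam d.contDiff 1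
  let e : ℝ → G n := fun s => c' s * ((c.toFun 1)⁻¹ * d' s)
  have he : ∀ i j, ContDiff ℝ 1 (fun s => (e s : Mat n) i j) :=
    contDiff_mul hc' (contDiff_mul (fun _ _ => contDiff_const) hd')
  have hd0 : ∀ s ≤ (1 / 2 : ℝ), d' s = d.toFun 0 := fun s hs => by
    simp only [d']; rw [Real.smoothTransition.zero_of_nonpos (by linarith)]
  have hc1 : ∀ s ≥ (1 / 2 : ℝ), c' s = c.toFun 1 := fun s hs => by
    simp only [c']; rw [Real.smoothTransition.one_of_one_le (by linarith)]
  let E : Curve x z :=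
    { toFun := e
      contDiff := he
      start_eq := by
        have h1 : e 0 = c.toFun 0 * k := by
          simp only [e]
          rw [hd0 0 (by norm_num)]
          simp [c', hkdef, Real.smoothTransition.zero]
        rw [h1, QuotientGroup.mk_mul_of_mem _ hk, c.start_eq]
      end_eq := by
        have h1 : e 1 = d.toFun 1 := by
          simp only [e]
          rw [hc1 1 (by norm_num)]
          norm_num [d', Real.smoothTransition.one]
        rw [h1, d.end_eq] }
  have hs1 : ∫ t in (0 : ℝ)..(1 / 2), speed e t = c.length := by
    have h1 : ∫ t in (0 : ℝ)..(1 / 2), speed e t = ∫ t in (0 : ℝ)..(1 / 2), speed c' t := by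
      refine intervalIntegral.integral_congr_ae ?_
      have hne : ∀ᵐ t : ℝ, t ≠ 1 / 2 := by simp [MeasureTheory.ae_iff]
      filter_upwards [hne] with t ht htm
      rw [Set.uIoc_of_le (by norm_num)] at htm
      have hlt : t < 1 / 2 := lt_of_le_of_ne htm.2 ht
      rw [← speed_right hk hc' t]
      apply speed_congr
      filter_upwards [Iio_mem_nhds hlt] with s hs
      simp only [e]
      rw [hd0 s (le_of_lt hs)]
    have h2 := length_reparam c.contDiff 0
    rw [h1, Curve.length, ← h2]
    norm_num [c']
  have hs2 : ∫ t in (1 / 2 : ℝ)..1, speed e t = d.length := by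
    have h1 : ∫ t in (1 / 2 : ℝ)..1, speed e t = ∫ t in (1 / 2 : ℝ)..1, speed d' t := by
      refine intervalIntegral.integral_congr_ae ?_
      refine Filter.Eventually.of_forall fun t htm => ?_
      rw [Set.uIoc_of_le (by norm_num)] at htm
      apply speed_congr
      filter_upwards [Ioi_mem_nhds htm.1] with s hs
      simp only [e]
      rw [hc1 s (le_of_lt hs), mul_inv_cancel_left]
    have h2 := length_reparam d.contDiff 1
    rw [h1, Curve.length, ← h2]
    norm_num [d']
  have hE : E.length = c.length + d.length := by
    rw [← hs1, ← hs2, Curve.length]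
    exact (intervalIntegral.integral_add_adjacent_intervals
      ((speed_continuous he).intervalIntegrable _ _)
      ((speed_continuous he).intervalIntegrable _ _)).symm
  calc zEDist x z ≤ ENNReal.ofReal E.length := iInf_le _ E
    _ ≤ _ := by rw [hE]; exact ENNReal.ofReal_add_le

theorem zEDist_triangle (x y z : Z n) : zEDist x z ≤ zEDist x y + zEDist y z :=
  ENNReal.le_iInf_add_iInf fun c d => zEDist_le_add c d

theorem det_exp_of_mem {X : Mat n} (hX : X ∈ pSpace n) : (NormedSpace.exp X).det = 1 := by
  obtain ⟨h1, h2⟩ := hX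
  have hs := h1.spectral_theorem
  have hU := h1.eigenvectorUnitary.2
  set U : Mat n := (h1.eigenvectorUnitary : Mat n) with hUdef
  have hUU : U * star U = 1 := Unitary.mul_star_self_of_mem hU
  have hUi : U⁻¹ = star U := Matrix.inv_eq_right_inv hUU
  have hunit : IsUnit U := ⟨⟨U, star U, hUU, Unitary.star_mul_self_of_mem hU⟩, rfl⟩
  have hX2 : X = U * Matrix.diagonal (fun i => (h1.eigenvalues i : ℂ)) * U⁻¹ := by
    rw [hUi]
    simpa [Unitary.conjStarAlgAut_apply, Function.comp_def] using hs
  rw [hX2, Matrix.exp_conj _ _ hunit, Matrix.det_conj hunit, Matrix.exp_diagonal,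
    Matrix.det_diagonal]
  have h3 : ∑ i, (h1.eigenvalues i : ℂ) = 0 := by
    rw [← h2]; exact h1.trace_eq_sum_eigenvalues.symm
  simp only [Pi.coe_exp, ← Complex.exp_eq_exp_ℂ]
  rw [← Complex.exp_sum, h3, Complex.exp_zero]

end DistLemmas

/-! ### Geodesics, rays and the boundary at infinity -/

/-- The matrix exponential as a map from `p` to `G`. -/
noncomputable def expG {n : ℕ} (X : pSpace n) : G n :=
  ⟨NormedSpace.exp (X : Mat n), det_exp_of_mem X.2⟩

/-- The geodesic `t ↦ g exp(tX) K` in `Z`, for `g ∈ G` and `X ∈ p`.  All geodesics of `Z` are of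
this form; `X` is the initial velocity, translated back to the base point by `g⁻¹`. -/
noncomputable def geod {n : ℕ} (g : G n) (X : pSpace n) (t : ℝ) : Z n :=
  QuotientGroup.mk (g * expG (t • X))

/-- A (full) geodesic of unit speed. -/
def IsUnitSpeedGeodesic {n : ℕ} (γ : ℝ → Z n) : Prop :=
  ∃ (g : G n) (X : pSpace n), killing (X : Mat n) X = 1 ∧ ∀ t, γ t = geod g X t

/-- A ray in `Z`: a half-geodesic of unit speed. -/
structure Ray (n : ℕ) where
  toFun : ℝ≥0 → Z n
  is_geod : ∃ (g : G n) (X : pSpace n), killing (X : Mat n) X = 1 ∧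
    ∀ t : ℝ≥0, toFun t = geod g X t

/-- Two rays are asymptotic if their distance is bounded. -/
def Asymptotic {n : ℕ} (δ₁ δ₂ : Ray n) : Prop :=
  ∃ M : ℝ≥0, ∀ t, zEDist (δ₁.toFun t) (δ₂.toFun t) ≤ M

/-- The equivalence relation of being asymptotic. -/
def asymptoticSetoid (n : ℕ) : Setoid (Ray n) where
  r := Asymptotic
  iseqv :=
    { refl := fun δ => ⟨0, fun t => by simp [zEDist_self]⟩
      symm := fun {δ₁ δ₂} ⟨M, hM⟩ => ⟨M, fun t => by rw [zEDist_comm]; exact hM t⟩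
      trans := fun {δ₁ δ₂ δ₃} ⟨M, hM⟩ ⟨N, hN⟩ => ⟨M + N, fun t =>
        (zEDist_triangle _ (δ₂.toFun t) _).trans (by
          rw [ENNReal.coe_add]; exact add_le_add (hM t) (hN t))⟩ }

/-- The boundary `Z(∞)`: the set of asymptoty classes of rays. -/
def Boundary (n : ℕ) := Quotient (asymptoticSetoid n)

/-- The class of a ray in `Z(∞)`. -/
def Ray.toBoundary {n : ℕ} (δ : Ray n) : Boundary n := Quotient.mk (asymptoticSetoid n) δ

/-- The translate of a ray by an element of `G`. -/
def Ray.translate {n : ℕ} (k : G n) (δ : Ray n) : Ray n where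
  toFun t := k • δ.toFun t
  is_geod := by
    obtain ⟨g, X, hX, h⟩ := δ.is_geod
    refine ⟨k * g, X, hX, fun t => ?_⟩
    rw [h t, geod, geod, mul_assoc]
    rfl

/-- The action of `G` on `Z(∞)` induced by its action on `Z` by isometries. -/
def Boundary.act {n : ℕ} (k : G n) : Boundary n → Boundary n :=
  Quotient.map (Ray.translate k) fun δ₁ δ₂ ⟨M, hM⟩ =>
    ⟨M, fun t => by simpa [Ray.translate, zEDist_smul] using hM t⟩

/-- `c` is the point `z_W` of `Z(∞)` attached to a non-trivial subspace `W` of `ℂⁿ`: the point whose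
stabilizer in `G` is the maximal parabolic subgroup stabilizing `W`. -/
def IsBoundaryPointOf {n : ℕ} (W : Submodule ℂ (Fin n → ℂ)) (c : Boundary n) : Prop :=
  ∀ k : G n, Boundary.act k c = c ↔ W.map (Matrix.toLin' (k : Mat n)) = W

/-- For `t → ∞` the geodesic `γ` runs to the boundary point `z_W`. -/
def EndsAt {n : ℕ} (γ : ℝ → Z n) (W : Submodule ℂ (Fin n → ℂ)) : Prop :=
  ∃ δ : Ray n, (∀ t : ℝ≥0, δ.toFun t = γ t) ∧ IsBoundaryPointOf W δ.toBoundary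

/-- The geodesic `γ` and the ray `δ`, which starts in `γ s`, meet at a right angle there: their
tangent vectors `X` and `Y` in `γ s = g K`, translated back to the base point by `g⁻¹`, are
orthogonal for the Killing form on `p`. -/
def MeetsAtRightAngle {n : ℕ} (γ : ℝ → Z n) (s : ℝ) (δ : Ray n) : Prop :=
  ∃ (g : G n) (X Y : pSpace n), (∀ t : ℝ, γ (s + t) = geod g X t) ∧
    (∀ t : ℝ≥0, δ.toFun t = geod g Y t) ∧ killing (X : Mat n) Y = 0

/-- `x` is a point on `γ` such that the ray `[x, z_W]` meets `γ` at a right angle. -/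
def IsGate {n : ℕ} (γ : ℝ → Z n) (W : Submodule ℂ (Fin n → ℂ)) (x : Z n) : Prop :=
  ∃ s : ℝ, γ s = x ∧ ∃ δ : Ray n, δ.toFun 0 = x ∧ IsBoundaryPointOf W δ.toBoundary ∧
    MeetsAtRightAngle γ s δ

open Classical in
/-- The oriented distance along `γ` of two points `x`, `y` on `γ`: the distance of `x` and `y`, with
a positive sign if `x` appears before `y` on `γ`, and with a negative sign otherwise. -/
noncomputable def distor {n : ℕ} (γ : ℝ → Z n) (x y : Z n) : ℝ :=
  if ∃ s t : ℝ, s ≤ t ∧ γ s = x ∧ γ t = y then zDist x y else - zDist x y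

/-! ### Hermitian metrics and the geodesics attached to them -/

/-- A hermitian metric, i.e. a positive definite hermitian form. -/
abbrev HermitianMetric (W : Type*) [AddCommGroup W] [Module ℂ W] := InnerProductSpace.Core ℂ W

/-- `W` is the direct sum of its subspaces `W₁` and `W₂`, and `h` is the orthogonal sum
`h₁ ⊕ h₂` of the hermitian metrics `h₁` and `h₂`. -/
structure IsOrthogonalSum {V : Type*} [AddCommGroup V] [Module ℂ V] {W₁ W₂ W : Submodule ℂ V}
    (h₁ : HermitianMetric W₁) (h₂ : HermitianMetric W₂) (h : HermitianMetric W) : Prop where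
  disjoint : Disjoint W₁ W₂
  sup_eq : W₁ ⊔ W₂ = W
  inner_left : ∀ (x y : V) (hx : x ∈ W₁) (hy : y ∈ W₁) (hx' : x ∈ W) (hy' : y ∈ W),
    h.inner ⟨x, hx'⟩ ⟨y, hy'⟩ = h₁.inner ⟨x, hx⟩ ⟨y, hy⟩
  inner_right : ∀ (x y : V) (hx : x ∈ W₂) (hy : y ∈ W₂) (hx' : x ∈ W) (hy' : y ∈ W),
    h.inner ⟨x, hx'⟩ ⟨y, hy'⟩ = h₂.inner ⟨x, hx⟩ ⟨y, hy⟩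
  inner_cross : ∀ (x y : V) (_ : x ∈ W₁) (_ : y ∈ W₂) (hx' : x ∈ W) (hy' : y ∈ W),
    h.inner ⟨x, hx'⟩ ⟨y, hy'⟩ = 0

/-- The vectors `g eᵢ`, for `i` in the index set `{i | P i}`, form an orthonormal basis of some
positive multiple of the hermitian metric `h` on `W`. -/
def MapsToOrthonormalBasis {n : ℕ} (g : G n) (P : Fin n → Prop) {W : Submodule ℂ (Fin n → ℂ)}
    (h : HermitianMetric W) : Prop :=
  ∃ (α : ℝ) (w : Module.Basis {i : Fin n // P i} ℂ W), 0 < α ∧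
    (∀ i, (w i : Fin n → ℂ) = (g : Mat n) *ᵥ Pi.single (i : Fin n) 1) ∧
    ∀ i j, (α : ℂ) * h.inner (w i) (w j) = if i = j then 1 else 0

/-- `γ` is a parametrization `g exp(t diag(ρ, …, ρ, σ, …, σ)) K` of the geodesic attached to the
classes (up to positive multiples) of hermitian metrics `h` on `W` and `h'` on `W'`, where
`ℂⁿ = W ⊕ W'`, `r = dim W`, the entry `ρ = √((n - r) / (4 r n²))` appears `r` times,
`σ = - r / (n - r) ρ`, and `g ∈ G` maps the first `r` standard basis vectors to an orthonormal
basis of a multiple of `h`, and the others to an orthonormal basis of a multiple of `h'`. -/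
def IsStandardParam {n : ℕ} {W W' : Submodule ℂ (Fin n → ℂ)}
    (h : HermitianMetric W) (h' : HermitianMetric W') (γ : ℝ → Z n) : Prop :=
  ∃ (g : G n) (X : pSpace n) (r : ℕ) (ρ σ : ℝ), r = Module.finrank ℂ W ∧
    ρ = √(((n : ℝ) - r) / (4 * r * (n : ℝ) ^ 2)) ∧ σ = - (r / ((n : ℝ) - r)) * ρ ∧
    MapsToOrthonormalBasis g (fun i => (i : ℕ) < r) h ∧
    MapsToOrthonormalBasis g (fun i => ¬ (i : ℕ) < r) h' ∧
    (X : Mat n) = Matrix.diagonal (fun i : Fin n => if (i : ℕ) < r then (ρ : ℂ) else (σ : ℂ)) ∧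
    ∀ t, γ t = geod g X t

/-- `γ` is a unit speed parametrization of the geodesic attached to the classes of the hermitian
metrics `h` on `W` and `h'` on `W'`, and it is oriented from (the boundary point of) `W` to (the
boundary point of) `W'`. -/
structure IsOrientedGeodesic {n : ℕ} {W W' : Submodule ℂ (Fin n → ℂ)}
    (h : HermitianMetric W) (h' : HermitianMetric W') (γ : ℝ → Z n) : Prop where
  reparam : ∃ γ₀ : ℝ → Z n, IsStandardParam h h' γ₀ ∧
    ∃ c : ℝ, (∀ t, γ t = γ₀ (c + t)) ∨ (∀ t, γ t = γ₀ (c - t))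
  starts_at : EndsAt (fun t => γ (-t)) W
  ends_at : EndsAt γ W'

/-! ### The Archimedean intersection number -/

/-- `z₁, …, zₙ` is an orthonormal basis of the dual space of `ℂⁿ` for the metric dual to `h`, i.e.
the dual basis of an orthonormal basis for `h`. -/
def IsOrthonormalCoframe {n : ℕ} (h : HermitianMetric (Fin n → ℂ))
    (z : Fin n → Module.Dual ℂ (Fin n → ℂ)) : Prop :=
  ∃ v : Fin n → (Fin n → ℂ), (∀ i j, h.inner (v i) (v j) = if i = j then 1 else 0) ∧
    ∀ i j, z i (v j) = if i = j then 1 else 0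

/-- `Λ` is the Levine form of the hyperplane `ℙ(C)` for the hermitian metric `h` on `ℂⁿ`: in
codimension one this is the function `log(|z₁|² + ⋯ + |zₙ|²) - log |z₁|²` on the complement of
`ℙ(C)`, where `z₁, …, zₙ` is an orthonormal basis of the dual space such that `C = ker z₁` (here
the index of the distinguished element is arbitrary).  The values on `ℙ(C)` are irrelevant. -/
def IsLevineForm {n : ℕ} (h : HermitianMetric (Fin n → ℂ)) (C : Submodule ℂ (Fin n → ℂ))
    (Λ : ℙ ℂ (Fin n → ℂ) → ℝ) : Prop :=
  ∃ (z : Fin n → Module.Dual ℂ (Fin n → ℂ)) (i₀ : Fin n), IsOrthonormalCoframe h z ∧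
    LinearMap.ker (z i₀) = C ∧
    ∀ (x : Fin n → ℂ) (hx : x ≠ 0), x ∉ C →
      Λ (Projectivization.mk ℂ x hx) = Real.log (∑ i, ‖z i x‖ ^ 2) - Real.log (‖z i₀ x‖ ^ 2)

/-- `m` is the Archimedean intersection number `⟨a - b, H_C - H_D⟩`, computed with the Levine forms
for some hermitian metric on `ℂⁿ`: the integral of `Λ_C - Λ_D` over the zero cycle `a - b`. -/
def IsIntersectionNumber {n : ℕ} (a b : ℙ ℂ (Fin n → ℂ)) (C D : Submodule ℂ (Fin n → ℂ))
    (m : ℝ) : Prop :=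
  ∃ (h : HermitianMetric (Fin n → ℂ)) (ΛC ΛD : ℙ ℂ (Fin n → ℂ) → ℝ),
    IsLevineForm h C ΛC ∧ IsLevineForm h D ΛD ∧ m = (ΛC a - ΛD a) - (ΛC b - ΛD b)

/-- The set of points of the linear subvariety `ℙ(C)`. -/
def projPoints {n : ℕ} (C : Submodule ℂ (Fin n → ℂ)) : Set (ℙ ℂ (Fin n → ℂ)) :=
  {x | x.submodule ≤ C}

end ArchInt

/-! Everything becomes explicit in coordinates adapted to γ. Since C has codimension 1, the
direction of γ is diagonal with one entry (n - 1)ρ at an index i₀ and entries -ρ elsewhere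
(`spike`). `IsOrientedGeodesic.exists_spike` writes γ as t ↦ g exp(tD)K, where C is the vanishing of
coordinate i₀ of g⁻¹v and the line ⟨A,B⟩ ∩ D is the vanishing of all the others.

Gates: at gK the direction towards z_A has w = g⁻¹a as its top eigenvector and a single other
eigenvalue. Its Killing product with a traceless X is therefore a positive multiple of w*Xw, and
-2w*Xw is the derivative of |g⁻¹a|² along X. So gates are critical points of gK ↦ |g⁻¹a|²
(`isGate_span_iff`). Along γ this function is exp(-2(n-1)ρt)|w_{i₀}|² + exp(2ρt)S, with S the sum of
the other |w_i|²; its only critical point is √(n-1) log((n-1)|w_{i₀}|²/S) (`isGate_geod_spike_iff`).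

Intersection number: Σ|z_i(x)|² is h(x,x) and cancels between C and D, so for equations φ of C and ψ
of D the number is log|ψ(a)/ψ(b)|² - log|φ(a)/φ(b)|² (`isIntersectionNumber_iff`). Coordinate i₀ is
an equation of C, and ψ(b)a - ψ(a)b lies on ⟨A,B⟩ ∩ D, so the remaining coordinates of a and b are
in the ratio ψ(a) : ψ(b). Substituting, the gate of B minus the gate of A is √(n-1) times the
intersection number (`gateTime_sub_gateTime`). If the two intersections coincide, φ(b)a - φ(a)b lies
in D and the two logarithms agree.

Two supports are needed. Distance is an infimum over curves, so its lower bound uses the functions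
log|gᴴv|², whose Lipschitz constant √(n-1)/n is attained along γ (`zDist_geod_spike`). Boundary
points are known only through stabilizers; `act_toBoundary_eq_iff` computes the stabilizer of the
end of a diagonal geodesic, from which its direction is recovered. -/

namespace ArchInt

variable {n : ℕ}

/-! ### Norm functions on Z and their Lipschitz constant -/

/-- The squared euclidean norm of a complex vector. -/
noncomputable def nsq (v : Fin n → ℂ) : ℝ := ∑ i, ‖v i‖ ^ 2

theorem nsq_eq_dotProduct (v : Fin n → ℂ) : (nsq v : ℂ) = star v ⬝ᵥ v := by
  simp [nsq, dotProduct, Complex.conj_mul']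

theorem nsq_nonneg (v : Fin n → ℂ) : 0 ≤ nsq v := Finset.sum_nonneg fun _ _ => sq_nonneg _

theorem nsq_eq_zero {v : Fin n → ℂ} : nsq v = 0 ↔ v = 0 := by
  rw [nsq, Finset.sum_eq_zero_iff_of_nonneg fun _ _ => sq_nonneg _]
  simp [funext_iff]

theorem nsq_pos {v : Fin n → ℂ} (hv : v ≠ 0) : 0 < nsq v :=
  (nsq_nonneg v).lt_of_ne' (mt nsq_eq_zero.1 hv)

theorem nsq_mulVec_of_unitary {U : Mat n} (hU : Uᴴ * U = 1) (v : Fin n → ℂ) :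
    nsq (U *ᵥ v) = nsq v := by
  have : (nsq (U *ᵥ v) : ℂ) = nsq v := by
    rw [nsq_eq_dotProduct, nsq_eq_dotProduct, Matrix.star_mulVec, ← Matrix.dotProduct_mulVec,
      Matrix.mulVec_mulVec, hU, Matrix.one_mulVec]
  exact_mod_cast this

theorem mem_K_iff {k : G n} : k ∈ K n ↔ (k : Mat n) * (k : Mat n)ᴴ = 1 := Iff.rfl

theorem conjTranspose_mul_of_mem_K {k : G n} (hk : k ∈ K n) : (k : Mat n)ᴴ * (k : Mat n) = 1 :=
  mul_eq_one_comm.mp hk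

theorem coe_inv_mul_coe (g : G n) : ((g⁻¹ : G n) : Mat n) * (g : Mat n) = 1 := by
  rw [← Matrix.SpecialLinearGroup.coe_mul]; simp

theorem coe_mul_coe_inv (g : G n) : (g : Mat n) * ((g⁻¹ : G n) : Mat n) = 1 := by
  rw [← Matrix.SpecialLinearGroup.coe_mul]; simp

theorem coe_inv_of_mem_K {k : G n} (hk : k ∈ K n) : ((k⁻¹ : G n) : Mat n) = (k : Mat n)ᴴ := by
  calc ((k⁻¹ : G n) : Mat n) = ((k⁻¹ : G n) : Mat n) * (k * (k : Mat n)ᴴ) := by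
        rw [mem_K_iff.1 hk, Matrix.mul_one]
    _ = _ := by rw [← Matrix.mul_assoc, coe_inv_mul_coe, Matrix.one_mul]

/-- Two representatives of a coset differ by a unitary factor on the right, so |gᴴv|² descends to Z;
the next lemma does the same for |g⁻¹v|². -/
theorem nsq_conjTranspose_mulVec_congr {g h : G n}
    (hgh : (QuotientGroup.mk g : Z n) = QuotientGroup.mk h) (v : Fin n → ℂ) :
    nsq ((g : Mat n)ᴴ *ᵥ v) = nsq ((h : Mat n)ᴴ *ᵥ v) := by
  have hk : g⁻¹ * h ∈ K n := QuotientGroup.eq.mp hgh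
  have h1 : (h : Mat n) = (g : Mat n) * ((g⁻¹ * h : G n) : Mat n) := by
    rw [← Matrix.SpecialLinearGroup.coe_mul, mul_inv_cancel_left]
  rw [h1, Matrix.conjTranspose_mul, ← Matrix.mulVec_mulVec]
  refine (nsq_mulVec_of_unitary ?_ _).symm
  rw [Matrix.conjTranspose_conjTranspose]
  exact hk

theorem nsq_inv_mulVec_congr {g h : G n}
    (hgh : (QuotientGroup.mk g : Z n) = QuotientGroup.mk h) (v : Fin n → ℂ) :
    nsq (((g⁻¹ : G n) : Mat n) *ᵥ v) = nsq (((h⁻¹ : G n) : Mat n) *ᵥ v) := by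
  have hk : g⁻¹ * h ∈ K n := QuotientGroup.eq.mp hgh
  have h1 : ((g⁻¹ : G n) : Mat n) = ((g⁻¹ * h : G n) : Mat n) * ((h⁻¹ : G n) : Mat n) := by
    rw [← Matrix.SpecialLinearGroup.coe_mul, mul_inv_cancel_right]
  rw [h1, ← Matrix.mulVec_mulVec, nsq_mulVec_of_unitary (conjTranspose_mul_of_mem_K hk)]

/-- Jacobi's formula along a curve in `SL(n, ℂ)`. -/
theorem trace_inv_mul_velocity {c : ℝ → G n}
    (hc : ∀ i j, ContDiff ℝ 1 (fun s => (c s : Mat n) i j)) (t : ℝ) :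
    ((((c t)⁻¹ : G n) : Mat n) * velocity c t).trace = 0 := by
  have h1 : HasDerivAt (fun s => (c s : Mat n).det)
      (∑ σ : Equiv.Perm (Fin n), (Equiv.Perm.sign σ : ℤ) *
        ∑ i, (∏ j ∈ Finset.univ.erase i, (c t : Mat n) (σ j) j) * velocity c t (σ i) i) t := by
    simp only [Matrix.det_apply']
    refine HasDerivAt.fun_sum fun σ _ => HasDerivAt.const_mul _ ?_
    have := HasDerivAt.fun_finsetProd (u := Finset.univ)
      (f := fun j s => (c s : Mat n) (σ j) j) (f' := fun j => velocity c t (σ j) j)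
      (x := t) fun i _ => velocity_hasDerivAt hc t (σ i) i
    simpa using this
  have h2 : HasDerivAt (fun s => (c s : Mat n).det) 0 t := by
    simp only [Matrix.SpecialLinearGroup.det_coe]
    exact hasDerivAt_const t _
  rw [← h1.unique h2, Matrix.SpecialLinearGroup.coe_inv, Matrix.trace]
  simp_rw [Finset.mul_sum]
  rw [Finset.sum_comm]
  refine Finset.sum_congr rfl fun i _ => ?_
  -- By Cramer's rule the i-th diagonal entry is the determinant with column i differentiated;
  -- summing over i gives the derivative of the Leibniz expansion.
  have h3 : ((c t : Mat n).adjugate * velocity c t).diag i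
      = ((c t : Mat n).updateCol i (fun k => velocity c t k i)).det := by
    rw [← Matrix.cramer_apply, Matrix.cramer_eq_adjugate_mulVec]
    rfl
  rw [h3, Matrix.det_apply']
  refine Finset.sum_congr rfl fun σ _ => ?_
  rw [← Finset.mul_prod_erase Finset.univ _ (Finset.mem_univ i), Matrix.updateCol_self,
    mul_comm (velocity c t (σ i) i)]
  congr 2
  refine Finset.prod_congr rfl fun j hj => ?_
  rw [Matrix.updateCol_ne (Finset.ne_of_mem_erase hj)]

theorem trace_mul_self_re_nonneg {H : Mat n} (hH : H.IsHermitian) : 0 ≤ (H * H).trace.re := by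
  have : (H * H).trace = ((∑ i, ∑ j, ‖H i j‖ ^ 2 : ℝ) : ℂ) := by
    rw [Matrix.trace]
    push_cast
    refine Finset.sum_congr rfl fun i _ => ?_
    rw [Matrix.diag_apply, Matrix.mul_apply]
    refine Finset.sum_congr rfl fun j _ => ?_
    rw [← hH.apply j i, ← Complex.mul_conj']
    rfl
  rw [this, Complex.ofReal_re]
  exact Finset.sum_nonneg fun _ _ => Finset.sum_nonneg fun _ _ => sq_nonneg _

/-- The sharp bound for the values of a traceless hermitian form on a vector. -/
theorem sq_dotProduct_mulVec_le {P : Mat n} (hP : P.IsHermitian) (htr : P.trace = 0)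
    (hn : 0 < n) (w : Fin n → ℂ) :
    (star w ⬝ᵥ P *ᵥ w).re ^ 2 ≤ ((n : ℝ) - 1) / n * (P * P).trace.re * nsq w ^ 2 := by
  set N := nsq w with hN
  have hn' : (n : ℝ) ≠ 0 := by positivity
  have hnc : (n : ℂ) ≠ 0 := by exact_mod_cast hn.ne'
  -- R is the traceless part of ww*. Since P is traceless, Tr(PR) is still w*Pw, while Tr(R²) drops
  -- from N² to (n-1)/n · N²: this makes the bound sharp.
  set R : Mat n := Matrix.vecMulVec w (star w) - ((N / n : ℝ) : ℂ) • (1 : Mat n) with hR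
  have hRh : R.IsHermitian := by
    refine Matrix.IsHermitian.sub ?_ ?_
    · ext i j; simp [Matrix.vecMulVec_apply, mul_comm]
    · change _ᴴ = _
      rw [Matrix.conjTranspose_smul]; simp
  have hPR : (P * R).trace = star w ⬝ᵥ P *ᵥ w := by
    rw [hR, Matrix.mul_sub, Matrix.trace_sub, Matrix.mul_smul, Matrix.mul_one, Matrix.trace_smul,
      htr, smul_zero, sub_zero, Matrix.mul_vecMulVec, Matrix.trace_vecMulVec, dotProduct_comm]
  have hRR : (R * R).trace.re = ((n : ℝ) - 1) / n * N ^ 2 := by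
    have h1 : (R * R).trace = ((((n : ℝ) - 1) / n * N ^ 2 : ℝ) : ℂ) := by
      have e : Matrix.vecMulVec w (star w) * Matrix.vecMulVec w (star w)
          = (N : ℂ) • Matrix.vecMulVec w (star w) := by
        rw [Matrix.vecMulVec_mul_vecMulVec, ← nsq_eq_dotProduct]
        ext i j; simp [Matrix.vecMulVec_apply, hN]; ring
      have e2 : (Matrix.vecMulVec w (star w)).trace = (N : ℂ) := by
        rw [Matrix.trace_vecMulVec, dotProduct_comm, ← nsq_eq_dotProduct]
      rw [hR]
      simp only [Matrix.sub_mul, Matrix.mul_sub, Matrix.mul_smul, Matrix.smul_mul, Matrix.mul_one,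
        Matrix.one_mul, Matrix.trace_sub, Matrix.trace_smul, Matrix.trace_one, e, e2, smul_eq_mul,
        Fintype.card_fin]
      push_cast
      field_simp
      ring
    rw [h1, Complex.ofReal_re]
  -- Cauchy–Schwarz for the trace form, from Tr((P + τR)²) ≥ 0 for every real τ.
  have hdisc := discrim_le_zero (a := (R * R).trace.re) (b := 2 * (P * R).trace.re)
    (c := (P * P).trace.re) (fun τ => by
      have h0 := trace_mul_self_re_nonneg (H := P + (τ : ℂ) • R) (hP.add (by
        change _ᴴ = _
        rw [Matrix.conjTranspose_smul, hRh.eq]; simp))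
      have h1 : ((P + (τ : ℂ) • R) * (P + (τ : ℂ) • R)).trace.re
          = (R * R).trace.re * (τ * τ) + 2 * (P * R).trace.re * τ + (P * P).trace.re := by
        simp only [Matrix.add_mul, Matrix.mul_add, Matrix.mul_smul, Matrix.smul_mul,
          Matrix.trace_add, Matrix.trace_smul, Complex.add_re, smul_eq_mul,
          Complex.re_ofReal_mul, Matrix.trace_mul_comm R P]
        ring
      rwa [h1] at h0)
  rw [discrim, hRR, hPR] at hdisc
  nlinarith [hdisc]

/-- The antihermitian part of M contributes only a purely imaginary number. -/
theorem re_star_dotProduct_pPart (M : Mat n) (w : Fin n → ℂ) :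
    (star w ⬝ᵥ pPart M *ᵥ w).re = (star w ⬝ᵥ Mᴴ *ᵥ w).re := by
  have h1 : star w ⬝ᵥ Mᴴ *ᵥ w = star (star w ⬝ᵥ M *ᵥ w) := by
    rw [Matrix.star_dotProduct, Matrix.star_mulVec, Matrix.dotProduct_mulVec]
    simp
  have h2 : (star w ⬝ᵥ M *ᵥ w).re = (star w ⬝ᵥ Mᴴ *ᵥ w).re := by
    rw [h1]; exact (Complex.conj_re _).symm
  rw [pPart, Matrix.smul_mulVec, Matrix.add_mulVec, dotProduct_smul, dotProduct_add, smul_eq_mul]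
  have : (1 / 2 : ℂ) = ((1 / 2 : ℝ) : ℂ) := by push_cast; rfl
  rw [this, Complex.re_ofReal_mul, Complex.add_re, h2]
  ring

theorem hasDerivAt_nsq {u : ℝ → Fin n → ℂ} {u' : Fin n → ℂ} {t : ℝ}
    (hu : ∀ i, HasDerivAt (fun s => u s i) (u' i) t) :
    HasDerivAt (fun s => nsq (u s)) (2 * (star (u t) ⬝ᵥ u').re) t := by
  have h1 : ∀ i, HasDerivAt (fun s => ‖u s i‖ ^ 2) (2 * (star (u t i) * u' i).re) t := by
    intro i
    have h := (hu i).norm_sq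
    convert h using 1
    rw [Complex.inner, mul_comm (u' i)]
    simp
  have h2 := HasDerivAt.fun_sum (u := Finset.univ) fun i _ => h1 i
  have e : 2 * (star (u t) ⬝ᵥ u').re = ∑ i, 2 * (star (u t i) * u' i).re := by
    simp [dotProduct, Finset.mul_sum, Complex.re_sum]
  rw [e]
  exact h2

theorem pPart_isHermitian (M : Mat n) : (pPart M).IsHermitian := by
  change _ᴴ = _
  rw [pPart, Matrix.conjTranspose_smul, Matrix.conjTranspose_add,
    Matrix.conjTranspose_conjTranspose, add_comm]
  simp

/-- For u = cᴴv and M = c⁻¹c' one has u' = Mᴴu, so the logarithmic derivative of |u|² sees only the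
hermitian part of M, the tangent vector, which is traceless by Jacobi's formula. The sharp bound
then applies, and the factor 4n in the Killing form turns 2√((n-1)/n) into √(n-1)/n. -/
theorem abs_log_nsq_sub_le_length (c : ℝ → G n) (hn : 0 < n)
    (hc : ∀ i j, ContDiff ℝ 1 (fun s => (c s : Mat n) i j)) {v : Fin n → ℂ} (hv : v ≠ 0) :
    |Real.log (nsq ((c 1 : Mat n)ᴴ *ᵥ v)) - Real.log (nsq ((c 0 : Mat n)ᴴ *ᵥ v))|
      ≤ √((n : ℝ) - 1) / n * ∫ t in (0 : ℝ)..1, speed c t := by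
  have hn1 : (1 : ℝ) ≤ n := by exact_mod_cast hn
  set u : ℝ → Fin n → ℂ := fun t => (c t : Mat n)ᴴ *ᵥ v with hu
  have hu0 : ∀ t, u t ≠ 0 := by
    intro t h
    apply hv
    have h1 : (((c t)⁻¹ : G n) : Mat n)ᴴ *ᵥ u t = v := by
      rw [hu, Matrix.mulVec_mulVec, ← Matrix.conjTranspose_mul, coe_mul_coe_inv]
      simp
    rw [← h1, h, Matrix.mulVec_zero]
  set M : ℝ → Mat n := fun t => (((c t)⁻¹ : G n) : Mat n) * velocity c t with hM
  have hud : ∀ t i, HasDerivAt (fun s => u s i) (((M t)ᴴ *ᵥ u t) i) t := by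
    intro t i
    have h1 : (M t)ᴴ *ᵥ u t = (velocity c t)ᴴ *ᵥ v := by
      rw [hu, hM, Matrix.mulVec_mulVec, ← Matrix.conjTranspose_mul, ← Matrix.mul_assoc,
        coe_mul_coe_inv, Matrix.one_mul]
    rw [h1]
    simp only [hu, Matrix.mulVec, dotProduct, Matrix.conjTranspose_apply]
    exact HasDerivAt.fun_sum fun k _ => ((velocity_hasDerivAt hc t k i).star).mul_const _
  set φ : ℝ → ℝ := fun t => Real.log (nsq (u t)) with hφ
  have hφd : ∀ t, HasDerivAt φ (2 * (star (u t) ⬝ᵥ (M t)ᴴ *ᵥ u t).re / nsq (u t)) t := fun t =>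
    (hasDerivAt_nsq (hud t)).log (nsq_pos (hu0 t)).ne'
  have hbound : ∀ t, |2 * (star (u t) ⬝ᵥ (M t)ᴴ *ᵥ u t).re / nsq (u t)|
      ≤ √((n : ℝ) - 1) / n * speed c t := by
    intro t
    have hpos := nsq_pos (hu0 t)
    have htr : (tangent c t).trace = 0 := by
      rw [tangent, pPart, Matrix.trace_smul, Matrix.trace_add, Matrix.trace_conjTranspose,
        trace_inv_mul_velocity hc t]
      simp
    have h1 := sq_dotProduct_mulVec_le (pPart_isHermitian (M t)) htr hn (u t)
    rw [re_star_dotProduct_pPart] at h1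
    apply abs_le_of_sq_le_sq
    · rw [mul_pow, speed, Real.sq_sqrt, div_pow, div_pow, Real.sq_sqrt (by linarith),
        div_le_iff₀ (by positivity), mul_pow]
      · change _ ≤ _ * killing (pPart (M t)) (pPart (M t)) * _
        rw [killing]
        have : ((n : ℝ) - 1) / n ^ 2 * (4 * n * (pPart (M t) * pPart (M t)).trace.re)
            * nsq (u t) ^ 2 = 4 * (((n : ℝ) - 1) / n *
            (pPart (M t) * pPart (M t)).trace.re * nsq (u t) ^ 2) := by
          field_simp
        rw [this]
        linarith
      · exact mul_nonneg (by positivity) (trace_mul_self_re_nonneg (pPart_isHermitian _))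
    · exact mul_nonneg (by positivity) (Real.sqrt_nonneg _)
  have hsc := speed_continuous hc
  set ψ : ℝ → ℝ := fun t => √((n : ℝ) - 1) / n * ∫ s in (0 : ℝ)..t, speed c s with hψ
  have hψd : ∀ t, HasDerivAt ψ (√((n : ℝ) - 1) / n * speed c t) t := fun t =>
    (intervalIntegral.integral_hasDerivAt_right (hsc.intervalIntegrable _ _)
      hsc.aestronglyMeasurable.stronglyMeasurableAtFilter hsc.continuousAt).const_mul _
  have hψ0 : ψ 0 = 0 := by simp [hψ]
  -- The derivative bound is integrated by monotonicity of ψ - φ and ψ + φ, one for each sign of the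
  -- absolute value.
  have hm1 : Monotone fun t => ψ t - φ t :=
    monotone_of_hasDerivAt_nonneg (fun t => (hψd t).sub (hφd t))
      fun t => sub_nonneg.2 ((le_abs_self _).trans (hbound t))
  have hm2 : Monotone fun t => ψ t + φ t :=
    monotone_of_hasDerivAt_nonneg (fun t => (hψd t).add (hφd t))
      fun t => by
        have := (neg_abs_le _).trans' (neg_le_neg (hbound t))
        simp only [Pi.zero_apply]
        linarith
  have e1 := hm1 zero_le_one
  have e2 := hm2 zero_le_one
  simp only [hψ0] at e1 e2
  exact abs_le.2 ⟨by simp only [hφ, hψ, hu] at e1 e2 ⊢; linarith,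
    by simp only [hφ, hψ, hu] at e1 e2 ⊢; linarith⟩

/-- The functions `gK ↦ log |gᴴ v|²` are Lipschitz, with the optimal constant. -/
theorem ofReal_abs_log_nsq_sub_le (hn : 2 ≤ n) (g h : G n) {v : Fin n → ℂ} (hv : v ≠ 0) :
    ENNReal.ofReal |Real.log (nsq ((h : Mat n)ᴴ *ᵥ v)) - Real.log (nsq ((g : Mat n)ᴴ *ᵥ v))|
      ≤ ENNReal.ofReal (√((n : ℝ) - 1) / n) *
        zEDist (QuotientGroup.mk g : Z n) (QuotientGroup.mk h) := by
  have hn' : (2 : ℝ) ≤ n := by exact_mod_cast hn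
  have hκ : 0 < √((n : ℝ) - 1) / n :=
    div_pos (Real.sqrt_pos.2 (by linarith)) (by linarith)
  rw [zEDist, ENNReal.mul_iInf_of_ne (ENNReal.ofReal_pos.2 hκ).ne' ENNReal.ofReal_ne_top]
  refine le_iInf fun c => ?_
  rw [← ENNReal.ofReal_mul hκ.le, ← nsq_conjTranspose_mulVec_congr c.start_eq,
    ← nsq_conjTranspose_mulVec_congr c.end_eq]
  exact ENNReal.ofReal_le_ofReal (abs_log_nsq_sub_le_length c.toFun (by omega) c.contDiff hv)

/-! ### Diagonal directions and reduction to them -/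

/-- A real diagonal matrix. -/
noncomputable def realDiag (x : Fin n → ℝ) : Mat n := Matrix.diagonal fun i => (x i : ℂ)

/-- A real diagonal matrix of trace zero as an element of `p`. -/
noncomputable def pDiag (x : Fin n → ℝ) (hx : ∑ i, x i = 0) : pSpace n :=
  ⟨realDiag x, by
    refine ⟨?_, ?_⟩
    · change _ᴴ = _
      rw [realDiag, Matrix.diagonal_conjTranspose]
      congr 1
      ext i
      simp
    · rw [realDiag, Matrix.trace_diagonal]
      exact_mod_cast hx⟩

theorem coe_pDiag (x : Fin n → ℝ) (hx : ∑ i, x i = 0) : (pDiag x hx : Mat n) = realDiag x := rfl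

theorem coe_expG_pDiag (x : Fin n → ℝ) (hx : ∑ i, x i = 0) (t : ℝ) :
    ((expG (t • pDiag x hx) : G n) : Mat n) = realDiag fun i => Real.exp (t * x i) := by
  change NormedSpace.exp (t • realDiag x) = _
  have : t • realDiag x = Matrix.diagonal fun i => ((t * x i : ℝ) : ℂ) := by
    rw [realDiag, ← Matrix.diagonal_smul]
    congr 1
    ext i
    simp
  rw [this, Matrix.exp_diagonal, realDiag]
  congr 1
  ext i
  rw [Pi.coe_exp, ← Complex.exp_eq_exp_ℂ, Complex.ofReal_exp]

theorem realDiag_mul (x y : Fin n → ℝ) : realDiag x * realDiag y = realDiag fun i => x i * y i := by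
  rw [realDiag, realDiag, Matrix.diagonal_mul_diagonal, realDiag]
  simp

theorem realDiag_one : realDiag (fun _ : Fin n => (1 : ℝ)) = 1 := by
  simp [realDiag]

theorem conjTranspose_realDiag (x : Fin n → ℝ) : (realDiag x)ᴴ = realDiag x := by
  rw [realDiag, Matrix.diagonal_conjTranspose]
  congr 1
  ext i
  simp

theorem realDiag_mulVec (x : Fin n → ℝ) (v : Fin n → ℂ) (i : Fin n) :
    (realDiag x *ᵥ v) i = x i * v i := by
  rw [realDiag, Matrix.mulVec_diagonal]

theorem expG_pDiag_add (x : Fin n → ℝ) (hx : ∑ i, x i = 0) (s t : ℝ) :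
    expG ((s + t) • pDiag x hx) = expG (s • pDiag x hx) * expG (t • pDiag x hx) := by
  apply Subtype.ext
  rw [Matrix.SpecialLinearGroup.coe_mul]
  simp only [coe_expG_pDiag, realDiag_mul, add_mul, Real.exp_add]

theorem expG_zero : expG (0 : pSpace n) = 1 := by
  apply Subtype.ext
  simp [expG]

theorem inv_expG_pDiag (x : Fin n → ℝ) (hx : ∑ i, x i = 0) (t : ℝ) :
    (expG (t • pDiag x hx))⁻¹ = expG ((-t) • pDiag x hx) := by
  rw [inv_eq_iff_mul_eq_one, ← expG_pDiag_add, add_neg_cancel, zero_smul, expG_zero]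

theorem killing_realDiag (x : Fin n → ℝ) :
    killing (realDiag x) (realDiag x) = 4 * n * ∑ i, x i ^ 2 := by
  rw [killing, realDiag_mul, realDiag, Matrix.trace_diagonal, ← Complex.ofReal_sum,
    Complex.ofReal_re]
  simp only [sq]

/-- Scaling by an n-th root ζ of the conjugate of det V makes the determinant 1. Since |ζ| = 1,
conjugation by V is unaffected, so spectral theorems hold with k in SU(n). -/
theorem exists_mem_K_eq_smul (hn : 0 < n) {V : Mat n} (hV : V * Vᴴ = 1) :
    ∃ k ∈ K n, ∃ ζ : ℂ, ζ * star ζ = 1 ∧ (k : Mat n) = ζ • V := by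
  have hd : V.det * star V.det = 1 := by
    rw [← Matrix.det_conjTranspose, ← Matrix.det_mul, hV, Matrix.det_one]
  obtain ⟨ζ, hζ⟩ := IsAlgClosed.exists_pow_nat_eq (star V.det) hn
  have hz : ζ * star ζ = 1 := by
    have h1 : ‖V.det‖ = 1 := by
      have := congrArg norm hd
      rw [norm_mul, norm_star, norm_one] at this
      nlinarith [norm_nonneg V.det]
    have h2 : ‖ζ‖ ^ n = 1 := by rw [← norm_pow, hζ, norm_star, h1]
    have h3 : ‖ζ‖ = 1 := (pow_eq_one_iff_of_nonneg (norm_nonneg _) hn.ne').1 h2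
    have h4 := Complex.mul_conj' ζ
    rw [h3] at h4
    simpa using h4
  refine ⟨⟨ζ • V, ?_⟩, ?_, ζ, hz, rfl⟩
  · rw [Matrix.det_smul, Fintype.card_fin, hζ, mul_comm, hd]
  · change (ζ • V) * (ζ • V)ᴴ = 1
    rw [Matrix.conjTranspose_smul, Matrix.smul_mul, Matrix.mul_smul, hV, smul_smul, hz, one_smul]

theorem exists_mem_K_diagonalizing (hn : 0 < n) {H : Mat n} (hH : H.IsHermitian) :
    ∃ k ∈ K n, ∃ x : Fin n → ℝ, H = (k : Mat n) * realDiag x * (k : Mat n)ᴴ := by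
  have hs := hH.spectral_theorem
  set U : Mat n := (hH.eigenvectorUnitary : Mat n)
  have hUU : U * Uᴴ = 1 := Unitary.mul_star_self_of_mem hH.eigenvectorUnitary.2
  obtain ⟨k, hk, ζ, hζ, hkU⟩ := exists_mem_K_eq_smul hn hUU
  refine ⟨k, hk, hH.eigenvalues, ?_⟩
  rw [hkU, Matrix.conjTranspose_smul, Matrix.smul_mul, Matrix.mul_smul, Matrix.smul_mul, smul_smul,
    mul_comm (star ζ), hζ, one_smul]
  conv_lhs => rw [hs]
  rfl

theorem expG_conj {k : G n} (hk : k ∈ K n) {X Y : pSpace n}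
    (hXY : (X : Mat n) = (k : Mat n) * (Y : Mat n) * (k : Mat n)ᴴ) (t : ℝ) :
    expG (t • X) = k * expG (t • Y) * k⁻¹ := by
  apply Subtype.ext
  rw [Matrix.SpecialLinearGroup.coe_mul, Matrix.SpecialLinearGroup.coe_mul, coe_inv_of_mem_K hk]
  have hinv : (k : Mat n)⁻¹ = (k : Mat n)ᴴ := Matrix.inv_eq_right_inv hk
  have hunit : IsUnit (k : Mat n) := ⟨⟨k, _, hk, conjTranspose_mul_of_mem_K hk⟩, rfl⟩
  change NormedSpace.exp (t • (X : Mat n)) = (k : Mat n) * NormedSpace.exp (t • (Y : Mat n)) * _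
  rw [← hinv, ← Matrix.exp_conj _ _ hunit, hXY, hinv, Matrix.mul_smul, Matrix.smul_mul]

theorem geod_conj {k : G n} (hk : k ∈ K n) {X Y : pSpace n}
    (hXY : (X : Mat n) = (k : Mat n) * (Y : Mat n) * (k : Mat n)ᴴ) (g : G n) (t : ℝ) :
    geod g X t = geod (g * k) Y t := by
  rw [geod, expG_conj hk hXY, geod, ← mul_assoc, ← mul_assoc]
  exact QuotientGroup.mk_mul_of_mem _ (inv_mem hk)

theorem killing_conj {k : G n} (hk : k ∈ K n) (X Y : Mat n) :
    killing ((k : Mat n) * X * (k : Mat n)ᴴ) ((k : Mat n) * Y * (k : Mat n)ᴴ) = killing X Y := by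
  have : ((k : Mat n) * X * (k : Mat n)ᴴ) * ((k : Mat n) * Y * (k : Mat n)ᴴ)
      = (k : Mat n) * (X * Y) * (k : Mat n)ᴴ := by
    rw [show ((k : Mat n) * X * (k : Mat n)ᴴ) * ((k : Mat n) * Y * (k : Mat n)ᴴ)
      = (k : Mat n) * X * ((k : Mat n)ᴴ * (k : Mat n)) * (Y * (k : Mat n)ᴴ) by
        simp only [Matrix.mul_assoc], conjTranspose_mul_of_mem_K hk]
    simp only [Matrix.mul_assoc, Matrix.mul_one]
  rw [killing, this, Matrix.trace_mul_comm, ← Matrix.mul_assoc, conjTranspose_mul_of_mem_K hk,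
    Matrix.one_mul, killing]

/-- Up to moving the base point in its fibre, the direction of a geodesic is diagonal. -/
theorem exists_diagonal_direction (hn : 0 < n) (X : pSpace n) :
    ∃ k ∈ K n, ∃ (x : Fin n → ℝ) (hx : ∑ i, x i = 0),
      (X : Mat n) = (k : Mat n) * (pDiag x hx : Mat n) * (k : Mat n)ᴴ := by
  obtain ⟨k, hk, x, h⟩ := exists_mem_K_diagonalizing hn X.2.1
  refine ⟨k, hk, x, ?_, h⟩
  have := X.2.2
  rw [h, Matrix.mul_assoc, Matrix.trace_mul_comm, Matrix.mul_assoc, conjTranspose_mul_of_mem_K hk,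
    Matrix.mul_one, realDiag, Matrix.trace_diagonal] at this
  exact_mod_cast this

theorem contDiff_expG_pDiag (x : Fin n → ℝ) (hx : ∑ i, x i = 0) (i j : Fin n) :
    ContDiff ℝ 1 (fun s : ℝ => ((expG (s • pDiag x hx) : G n) : Mat n) i j) := by
  simp only [coe_expG_pDiag, realDiag, Matrix.diagonal_apply]
  split_ifs
  · exact Complex.ofRealCLM.contDiff.comp (Real.contDiff_exp.comp (contDiff_id.mul contDiff_const))
  · exact contDiff_const

theorem speed_expG_pDiag (x : Fin n → ℝ) (hx : ∑ i, x i = 0) (t : ℝ) :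
    speed (fun s => expG (s • pDiag x hx)) t = √(killing (realDiag x) (realDiag x)) := by
  have hv : velocity (fun s : ℝ => expG (s • pDiag x hx)) t
      = realDiag fun i => Real.exp (t * x i) * x i := by
    apply velocity_eq
    intro i j
    simp only [coe_expG_pDiag, realDiag, Matrix.diagonal_apply]
    split_ifs
    · have := ((hasDerivAt_id t).mul_const (x i)).exp
      simpa using this.ofReal_comp
    · exact hasDerivAt_const _ _
  have ht : tangent (fun s : ℝ => expG (s • pDiag x hx)) t = realDiag x := by
    rw [tangent, hv, inv_expG_pDiag, coe_expG_pDiag, realDiag_mul]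
    have : (fun i => Real.exp (-t * x i) * (Real.exp (t * x i) * x i)) = x := by
      ext i
      rw [← mul_assoc, ← Real.exp_add]
      simp
    rw [this, pPart, conjTranspose_realDiag, ← two_smul ℂ, smul_smul]
    norm_num
  rw [speed, ht]

/-- The geodesic segment itself, at constant speed, is a competitor in the infimum; conjugation by K
reduces its speed to the diagonal case. -/
theorem zEDist_geod_le (hn : 0 < n) (g : G n) (X : pSpace n) (s t : ℝ) :
    zEDist (geod g X s) (geod g X t) ≤ ENNReal.ofReal (|t - s| * √(killing (X : Mat n) X)) := by
  obtain ⟨k, hk, x, hx, hX⟩ := exists_diagonal_direction hn X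
  rw [geod_conj hk hX, geod_conj hk hX, hX, killing_conj hk, coe_pDiag]
  have hfd : ∀ τ, HasDerivAt (fun τ : ℝ => s + τ * (t - s)) (t - s) τ := fun τ => by
    simpa using ((hasDerivAt_id τ).mul_const (t - s)).const_add s
  have hc : ∀ i j, ContDiff ℝ 1
      (fun τ : ℝ => ((expG ((s + τ * (t - s)) • pDiag x hx) : G n) : Mat n) i j) := fun i j =>
    (contDiff_expG_pDiag x hx i j).comp (contDiff_const.add (contDiff_id.mul contDiff_const))
  let c : Curve (geod (g * k) (pDiag x hx) s) (geod (g * k) (pDiag x hx) t) :=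
    ⟨fun τ => (g * k) * expG ((s + τ * (t - s)) • pDiag x hx),
      contDiff_mul (fun _ _ => contDiff_const) hc, by simp [geod], by simp [geod]⟩
  have hs : ∀ τ, speed c.toFun τ = |t - s| * √(killing (realDiag x) (realDiag x)) := by
    intro τ
    rw [speed_left (g * k) hc, speed_comp (contDiff_expG_pDiag x hx) (hfd τ), speed_expG_pDiag]
  refine (iInf_le _ c).trans_eq ?_
  simp [Curve.length, hs]

/-! ### Bounded sets and stabilizers of boundary points -/

/-- The squared Frobenius norm. -/
noncomputable def frobSq (A : Mat n) : ℝ := ∑ i, ∑ j, ‖A i j‖ ^ 2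

/-- Diagonalize ggᴴ = k diag(p) kᴴ and put x = (log p)/2: then (k exp x)⁻¹g is unitary. The product
of the p_i is det(ggᴴ) = 1, hence Σx_i = 0, and each p_i is at most their sum, the squared Frobenius
norm. -/
theorem exists_polar (hn : 0 < n) (g : G n) :
    ∃ k ∈ K n, ∃ (x : Fin n → ℝ) (hx : ∑ i, x i = 0),
      (QuotientGroup.mk g : Z n) = QuotientGroup.mk (k * expG ((1 : ℝ) • pDiag x hx)) ∧
      ∀ i, Real.exp (2 * x i) ≤ frobSq (g : Mat n) := by
  obtain ⟨k, hk, p, hp⟩ := exists_mem_K_diagonalizing hn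
    (H := (g : Mat n) * (g : Mat n)ᴴ) (Matrix.isHermitian_mul_conjTranspose_self _)
  have hkk := conjTranspose_mul_of_mem_K hk
  have hp2 : (k : Mat n)ᴴ * ((g : Mat n) * (g : Mat n)ᴴ) * (k : Mat n) = realDiag p := by
    rw [hp, show (k : Mat n)ᴴ * ((k : Mat n) * realDiag p * (k : Mat n)ᴴ) * (k : Mat n)
      = ((k : Mat n)ᴴ * (k : Mat n)) * realDiag p * ((k : Mat n)ᴴ * (k : Mat n)) by
        simp only [Matrix.mul_assoc], hkk, Matrix.one_mul, Matrix.mul_one]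
  have hpn : ∀ i, p i = nsq fun j => ((g : Mat n)ᴴ * (k : Mat n)) j i := by
    intro i
    have h1 := congrFun (congrFun hp2 i) i
    rw [realDiag, Matrix.diagonal_apply_eq] at h1
    have h2 : (k : Mat n)ᴴ * ((g : Mat n) * (g : Mat n)ᴴ) * (k : Mat n)
        = ((g : Mat n)ᴴ * (k : Mat n))ᴴ * ((g : Mat n)ᴴ * (k : Mat n)) := by
      rw [Matrix.conjTranspose_mul, Matrix.conjTranspose_conjTranspose]
      simp only [Matrix.mul_assoc]
    rw [h2, Matrix.mul_apply] at h1
    have h3 : (p i : ℂ) = (nsq fun j => ((g : Mat n)ᴴ * (k : Mat n)) j i : ℝ) := by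
      rw [nsq_eq_dotProduct, ← h1]
      rfl
    exact_mod_cast h3
  have hp0 : ∀ i, 0 ≤ p i := fun i => by rw [hpn]; exact nsq_nonneg _
  have hprod : ∏ i, p i = 1 := by
    have h1 := congrArg Matrix.det hp2
    rw [realDiag, Matrix.det_diagonal, Matrix.det_mul, Matrix.det_mul, Matrix.det_mul,
      Matrix.det_conjTranspose, Matrix.det_conjTranspose] at h1
    simp only [Matrix.SpecialLinearGroup.det_coe] at h1
    have h2 : ((∏ i, p i : ℝ) : ℂ) = 1 := by
      push_cast
      rw [← h1]
      simp
    exact_mod_cast h2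
  have hpos : ∀ i, 0 < p i := fun i => (hp0 i).lt_of_ne' fun h => by
    rw [Finset.prod_eq_zero (Finset.mem_univ i) h] at hprod
    exact zero_ne_one hprod
  have hsum : ∑ i, p i = frobSq (g : Mat n) := by
    have h1 := congrArg Matrix.trace hp2
    rw [Matrix.trace_mul_comm, ← Matrix.mul_assoc, mem_K_iff.1 hk, Matrix.one_mul, realDiag,
      Matrix.trace_diagonal, Matrix.trace] at h1
    have h2 : ((∑ i, p i : ℝ) : ℂ) = (frobSq (g : Mat n) : ℝ) := by
      push_cast
      rw [← h1, frobSq]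
      push_cast
      refine Finset.sum_congr rfl fun i _ => ?_
      rw [Matrix.diag_apply, Matrix.mul_apply]
      exact Finset.sum_congr rfl fun j _ => Complex.mul_conj' _
    exact_mod_cast h2
  have he : ∀ i, Real.exp (2 * (Real.log (p i) / 2)) = p i := fun i => by
    rw [mul_div_cancel₀ _ two_ne_zero, Real.exp_log (hpos i)]
  have hx : ∑ i, Real.log (p i) / 2 = 0 := by
    rw [← Finset.sum_div, ← Real.log_prod fun i _ => (hpos i).ne', hprod]
    simp
  refine ⟨k, hk, fun i => Real.log (p i) / 2, hx, ?_, fun i => ?_⟩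
  · refine (QuotientGroup.eq.mpr ?_).symm
    rw [mem_K_iff, mul_inv_rev, inv_expG_pDiag, Matrix.SpecialLinearGroup.coe_mul,
      Matrix.SpecialLinearGroup.coe_mul, coe_inv_of_mem_K hk, coe_expG_pDiag]
    set E := realDiag fun i => Real.exp (-1 * (Real.log (p i) / 2)) with hE
    rw [show E * (k : Mat n)ᴴ * (g : Mat n) * (E * (k : Mat n)ᴴ * (g : Mat n))ᴴ
      = E * ((k : Mat n)ᴴ * ((g : Mat n) * (g : Mat n)ᴴ) * (k : Mat n)) * Eᴴ by
        simp only [Matrix.conjTranspose_mul, Matrix.conjTranspose_conjTranspose, Matrix.mul_assoc],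
      hp2, hE, conjTranspose_realDiag, realDiag_mul, realDiag_mul, ← realDiag_one]
    congr 1
    ext i
    rw [← he i, ← Real.exp_add, ← Real.exp_add, he i, Real.exp_eq_one_iff]
    ring
  · rw [he, ← hsum]
    exact Finset.single_le_sum (fun j _ => hp0 j) (Finset.mem_univ i)

theorem smul_mk (g h : G n) : g • (QuotientGroup.mk h : Z n) = QuotientGroup.mk (g * h) := rfl

/-- Bounded subsets of `G` have bounded images in `Z`. -/
theorem exists_zEDist_le_of_frobSq_le (hn : 0 < n) (M : ℝ) :
    ∃ C : ℝ≥0, ∀ g : G n, frobSq (g : Mat n) ≤ M →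
      zEDist (QuotientGroup.mk 1 : Z n) (QuotientGroup.mk g) ≤ C := by
  refine ⟨(√(4 * n * ∑ _i : Fin n, (n * (Real.log M / 2)) ^ 2)).toNNReal, fun g hg => ?_⟩
  obtain ⟨k, hk, x, hx, hgk, hbound⟩ := exists_polar hn g
  have hle : ∀ i, x i ≤ Real.log M / 2 := fun i => by
    have := Real.log_le_log (Real.exp_pos _) ((hbound i).trans hg)
    rw [Real.log_exp] at this
    linarith
  have hsq : ∀ i, x i ^ 2 ≤ (n * (Real.log M / 2)) ^ 2 := by
    intro i
    set L := Real.log M / 2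
    -- The upper bounds x_j ≤ L together with Σx_j = 0 also bound each x_i from below, since every
    -- summand L - x_j is nonnegative.
    have h1 : ∑ j, (L - x j) = n * L := by
      rw [Finset.sum_sub_distrib, hx]; simp
    have h2 : L - x i ≤ n * L := by
      rw [← h1]
      exact Finset.single_le_sum (f := fun j => L - x j) (fun j _ => sub_nonneg.2 (hle j))
        (Finset.mem_univ i)
    have hn1 : (1 : ℝ) ≤ n := by exact_mod_cast hn
    have h0 : 0 ≤ L := by
      have : 0 ≤ n * L := by
        rw [← h1]; exact Finset.sum_nonneg fun j _ => sub_nonneg.2 (hle j)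
      nlinarith
    exact sq_le_sq' (by nlinarith) ((hle i).trans (by nlinarith))
  have h1 : (QuotientGroup.mk 1 : Z n) = k • geod 1 (pDiag x hx) 0 := by
    rw [geod, zero_smul, expG_zero, smul_mk, mul_one, mul_one, ← one_mul k,
      QuotientGroup.mk_mul_of_mem _ hk]
  have h2 : (QuotientGroup.mk g : Z n) = k • geod 1 (pDiag x hx) 1 := by
    rw [hgk, geod, one_mul, smul_mk]
  rw [h1, h2, zEDist_smul]
  refine (zEDist_geod_le hn _ _ _ _).trans ?_
  rw [coe_pDiag, killing_realDiag, sub_zero, abs_one, one_mul]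
  refine ENNReal.ofReal_le_ofReal (Real.sqrt_le_sqrt ?_)
  exact mul_le_mul_of_nonneg_left (Finset.sum_le_sum fun i _ => hsq i) (by positivity)

/-- For v = e_i the Lipschitz function log|gᴴv|² is the logarithm of the squared norm of row i, and
it vanishes at the base point. This is a converse to the preceding bound. -/
theorem exists_norm_apply_le_of_zEDist_le (hn : 2 ≤ n) (M : ℝ≥0) :
    ∃ C : ℝ, ∀ g : G n, zEDist (QuotientGroup.mk 1 : Z n) (QuotientGroup.mk g) ≤ M →
      ∀ i j, ‖(g : Mat n) i j‖ ≤ C := by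
  refine ⟨√(Real.exp (√((n : ℝ) - 1) / n * M)), fun g hg i j => ?_⟩
  have h1 := ofReal_abs_log_nsq_sub_le hn 1 g (v := Pi.single i 1) (by simp)
  have h2 : ENNReal.ofReal (√((n : ℝ) - 1) / n) * zEDist (QuotientGroup.mk 1 : Z n)
      (QuotientGroup.mk g) ≤ ENNReal.ofReal (√((n : ℝ) - 1) / n * M) := by
    rw [ENNReal.ofReal_mul (by positivity), ENNReal.ofReal_coe_nnreal]
    gcongr
  have h3 := (ENNReal.ofReal_le_ofReal_iff (by positivity)).1 (h1.trans h2)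
  have h4 : nsq (((1 : G n) : Mat n)ᴴ *ᵥ Pi.single i 1) = 1 := by
    simp [nsq, Matrix.one_apply, apply_ite]
  have h5 : nsq ((g : Mat n)ᴴ *ᵥ Pi.single i 1) = ∑ l, ‖(g : Mat n) i l‖ ^ 2 := by
    simp [nsq]
  rw [h4, Real.log_one, sub_zero, h5] at h3
  have h6 : ‖(g : Mat n) i j‖ ^ 2 ≤ ∑ l, ‖(g : Mat n) i l‖ ^ 2 :=
    Finset.single_le_sum (f := fun l => ‖(g : Mat n) i l‖ ^ 2) (fun _ _ => sq_nonneg _)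
      (Finset.mem_univ j)
  apply Real.le_sqrt_of_sq_le
  refine h6.trans ?_
  rcases (Finset.sum_nonneg fun l (_ : l ∈ Finset.univ) => sq_nonneg ‖(g : Mat n) i l‖).eq_or_lt
    with h0 | h0
  · rw [← h0]; positivity
  · exact (Real.log_le_iff_le_exp h0).1 ((le_abs_self _).trans h3)

/-- The stabilizer in `G` of the end of a diagonal geodesic. -/
theorem act_toBoundary_eq_iff (hn : 2 ≤ n) {g : G n} {x : Fin n → ℝ} {hx : ∑ i, x i = 0}
    {δ : Ray n} (hδ : ∀ t : ℝ≥0, δ.toFun t = geod g (pDiag x hx) t) (k : G n) :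
    Boundary.act k δ.toBoundary = δ.toBoundary ↔
      ∀ i j, x i < x j → ((g⁻¹ * k * g : G n) : Mat n) i j = 0 := by
  -- Moving δ(t) to the base point by an isometry, the distance from kδ(t) to δ(t) becomes that from
  -- the base point to q(t)K. Conjugation scales entry (i, j) by exp(-t(x_i - x_j)), so q(t) stays
  -- bounded for t ≥ 0 exactly when the entries with x_i < x_j vanish.
  set q : ℝ → G n := fun t => expG ((-t) • pDiag x hx) * (g⁻¹ * k * g) * expG (t • pDiag x hx)
    with hq
  have hqe : ∀ t i j, (q t : Mat n) i j
      = (Real.exp (-(t * (x i - x j))) : ℝ) * ((g⁻¹ * k * g : G n) : Mat n) i j := by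
    intro t i j
    rw [hq]
    simp only [Matrix.SpecialLinearGroup.coe_mul, coe_expG_pDiag, realDiag,
      Matrix.mul_diagonal, Matrix.diagonal_mul]
    rw [show -(t * (x i - x j)) = -t * x i + t * x j by ring, Real.exp_add]
    push_cast
    ring
  have hdist : ∀ t : ℝ≥0, zEDist (k • δ.toFun t) (δ.toFun t)
      = zEDist (QuotientGroup.mk 1 : Z n) (QuotientGroup.mk (q t)) := by
    intro t
    rw [zEDist_comm, hδ, ← zEDist_smul (g * expG ((t : ℝ) • pDiag x hx)) (QuotientGroup.mk 1)]
    congr 1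
    · rw [smul_mk, mul_one, geod]
    · rw [smul_mk, geod, smul_mk, hq]
      simp only
      rw [← inv_expG_pDiag]
      congr 1
      group
  have hact : Boundary.act k δ.toBoundary = δ.toBoundary ↔
      ∃ M : ℝ≥0, ∀ t : ℝ≥0, zEDist (QuotientGroup.mk 1 : Z n) (QuotientGroup.mk (q t)) ≤ M := by
    simp_rw [← hdist]
    exact Quotient.eq (r := asymptoticSetoid n) (x := δ.translate k) (y := δ)
  rw [hact]
  constructor
  · rintro ⟨M, hM⟩ i j hij
    obtain ⟨C, hC⟩ := exists_norm_apply_le_of_zEDist_le hn M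
    by_contra hne
    set e := ((g⁻¹ * k * g : G n) : Mat n) i j with he
    have hpos : 0 < ‖e‖ := norm_pos_iff.2 hne
    have h1 : ∀ t : ℝ≥0, Real.exp (t * (x j - x i)) * ‖e‖ ≤ C := by
      intro t
      have := hC _ (hM t) i j
      rw [hqe, norm_mul, Complex.norm_real, Real.norm_of_nonneg (Real.exp_pos _).le] at this
      rwa [show (t : ℝ) * (x j - x i) = -(t * (x i - x j)) by ring]
    have hd : 0 < x j - x i := sub_pos.2 hij
    have hC0 : 0 ≤ C := by
      have := h1 0
      exact (mul_nonneg (Real.exp_pos _).le hpos.le).trans this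
    -- At this time the exponent is C/‖e‖, and exp(y) ≥ 1 + y makes the left side at least C + ‖e‖.
    have h2 := h1 ⟨(C / ‖e‖) / (x j - x i), by positivity⟩
    have h3 := Real.add_one_le_exp (C / ‖e‖ / (x j - x i) * (x j - x i))
    change Real.exp (C / ‖e‖ / (x j - x i) * (x j - x i)) * ‖e‖ ≤ C at h2
    have h4 : C / ‖e‖ / (x j - x i) * (x j - x i) * ‖e‖ = C := by
      field_simp
    nlinarith
  · intro h0
    obtain ⟨C, hC⟩ := exists_zEDist_le_of_frobSq_le (n := n) (by omega)
      (frobSq ((g⁻¹ * k * g : G n) : Mat n))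
    refine ⟨C, fun t => hC _ ?_⟩
    refine Finset.sum_le_sum fun i _ => Finset.sum_le_sum fun j _ => ?_
    rw [hqe, norm_mul, Complex.norm_real, Real.norm_of_nonneg (Real.exp_pos _).le, mul_pow]
    rcases lt_or_ge (x i) (x j) with hij | hij
    · rw [h0 i j hij]; simp
    · refine mul_le_of_le_one_left (sq_nonneg _) (pow_le_one₀ (Real.exp_pos _).le ?_)
      rw [Real.exp_le_one_iff]
      have := mul_nonneg t.2 (sub_nonneg.2 hij)
      change -((t : ℝ) * _) ≤ 0
      linarith [show (0 : ℝ) ≤ (t : ℝ) * (x i - x j) from this]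

theorem coe_mulVec_inv_mulVec (g : G n) (v : Fin n → ℂ) :
    (g : Mat n) *ᵥ (((g⁻¹ : G n) : Mat n) *ᵥ v) = v := by
  rw [Matrix.mulVec_mulVec, coe_mul_coe_inv, Matrix.one_mulVec]

theorem inv_mulVec_coe_mulVec (g : G n) (v : Fin n → ℂ) :
    ((g⁻¹ : G n) : Mat n) *ᵥ ((g : Mat n) *ᵥ v) = v := by
  rw [Matrix.mulVec_mulVec, coe_inv_mul_coe, Matrix.one_mulVec]

theorem inv_mulVec_ne_zero (g : G n) {v : Fin n → ℂ} (hv : v ≠ 0) :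
    ((g⁻¹ : G n) : Mat n) *ᵥ v ≠ 0 := fun h => hv <| by
  rw [← coe_mulVec_inv_mulVec g v, h, Matrix.mulVec_zero]

theorem inv_mulVec_coe_mulVec_coe_mulVec (g k : G n) (v : Fin n → ℂ) :
    ((g⁻¹ : G n) : Mat n) *ᵥ ((k : Mat n) *ᵥ ((g : Mat n) *ᵥ v))
      = ((g⁻¹ * k * g : G n) : Mat n) *ᵥ v := by
  simp only [Matrix.SpecialLinearGroup.coe_mul, Matrix.mulVec_mulVec, Matrix.mul_assoc]

theorem map_toLin'_eq_of_le (k : G n) {W : Submodule ℂ (Fin n → ℂ)}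
    (h : W.map (Matrix.toLin' (k : Mat n)) ≤ W) : W.map (Matrix.toLin' (k : Mat n)) = W := by
  apply Submodule.eq_of_le_of_finrank_eq h
  refine (Submodule.equivMapOfInjective _ ?_ W).finrank_eq.symm
  intro v w hvw
  rw [Matrix.toLin'_apply, Matrix.toLin'_apply] at hvw
  rw [← inv_mulVec_coe_mulVec k v, hvw, inv_mulVec_coe_mulVec]

/-- The end of a geodesic whose direction has two eigenvalues. -/
theorem isBoundaryPointOf_of_two_valued (hn : 2 ≤ n) {g : G n} {x : Fin n → ℝ}
    {hx : ∑ i, x i = 0} {δ : Ray n} (hδ : ∀ t : ℝ≥0, δ.toFun t = geod g (pDiag x hx) t)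
    {P : Fin n → Prop} (hP : ∀ i j, x i < x j ↔ ¬ P i ∧ P j) {W : Submodule ℂ (Fin n → ℂ)}
    (hW : ∀ v, v ∈ W ↔ ∀ i, ¬ P i → (((g⁻¹ : G n) : Mat n) *ᵥ v) i = 0) :
    IsBoundaryPointOf W δ.toBoundary := by
  intro k
  rw [act_toBoundary_eq_iff hn hδ]
  constructor
  -- W is spanned by the columns of g with index in P, so the hypothesis says that g⁻¹kg is block
  -- triangular and preserves W.
  · intro h
    apply map_toLin'_eq_of_le
    rintro _ ⟨v, hv, rfl⟩
    rw [Matrix.toLin'_apply, hW]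
    intro i hi
    rw [← coe_mulVec_inv_mulVec g v, inv_mulVec_coe_mulVec_coe_mulVec]
    change (∑ j : Fin n, _ * _) = (0 : ℂ)
    refine Finset.sum_eq_zero fun j _ => ?_
    by_cases hj : P j
    · rw [h i j ((hP i j).2 ⟨hi, hj⟩), zero_mul]
    · rw [(hW v).1 hv j hj, mul_zero]
  · intro h i j hij
    obtain ⟨hi, hj⟩ := (hP i j).1 hij
    have h1 : (g : Mat n) *ᵥ Pi.single j 1 ∈ W := by
      rw [hW]
      intro l hl
      rw [inv_mulVec_coe_mulVec, Pi.single_eq_of_ne]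
      rintro rfl
      exact hl hj
    have h2 : (k : Mat n) *ᵥ ((g : Mat n) *ᵥ Pi.single j 1) ∈ W := by
      rw [← h]
      exact ⟨_, h1, Matrix.toLin'_apply _ _⟩
    have h3 := (hW _).1 h2 i hi
    rw [inv_mulVec_coe_mulVec_coe_mulVec, Matrix.mulVec_single_one] at h3
    exact h3

/-- The direction of a diagonal geodesic which ends in the boundary point of a line. -/
theorem direction_of_isBoundaryPointOf_span (hn : 2 ≤ n) {g : G n} {x : Fin n → ℝ}
    {hx : ∑ i, x i = 0} {δ : Ray n} (hδ : ∀ t : ℝ≥0, δ.toFun t = geod g (pDiag x hx) t)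
    {a : Fin n → ℂ} (ha : a ≠ 0) (h : IsBoundaryPointOf (Submodule.span ℂ {a}) δ.toBoundary) :
    ∃ i₀, (∀ i, i ≠ i₀ → (((g⁻¹ : G n) : Mat n) *ᵥ a) i = 0) ∧
      ∃ μ, μ < x i₀ ∧ ∀ i, i ≠ i₀ → x i = μ := by
  set w := ((g⁻¹ : G n) : Mat n) *ᵥ a with hw
  have hw0 : w ≠ 0 := inv_mulVec_ne_zero g ha
  have hgw : (g : Mat n) *ᵥ w = a := coe_mulVec_inv_mulVec g a
  -- Transvections probe the stabilizer: the conjugate by g of 1 + E_ij fixes the end of δ iff x_j ≤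
  -- x_i, and it preserves the line of a iff w_j = 0.
  have key : ∀ i j, i ≠ j → (x j ≤ x i ↔ w j = 0) := by
    intro i j hij
    let T : G n := ⟨Matrix.transvection i j 1, Matrix.det_transvection_of_ne i j hij 1⟩
    have hT : (T : Mat n) = 1 + Matrix.single i j 1 := rfl
    have hTw : (T : Mat n) *ᵥ w = w + Pi.single i (w j) := by
      rw [hT, Matrix.add_mulVec, Matrix.one_mulVec]
      congr 1
      ext l
      rw [Matrix.single_mulVec]
      simp [Function.update, Pi.single_apply]
    have hka : ((g * T * g⁻¹ : G n) : Mat n) *ᵥ a = (g : Mat n) *ᵥ ((T : Mat n) *ᵥ w) := by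
      simp only [Matrix.SpecialLinearGroup.coe_mul, ← Matrix.mulVec_mulVec, hw]
    have h1 : x j ≤ x i ↔ ∀ p q, x p < x q →
        ((g⁻¹ * (g * T * g⁻¹) * g : G n) : Mat n) p q = 0 := by
      rw [show g⁻¹ * (g * T * g⁻¹) * g = T by group, hT]
      constructor
      · intro hle p q hpq
        have hne : p ≠ q := by rintro rfl; exact lt_irrefl _ hpq
        rw [Matrix.add_apply, Matrix.one_apply_ne hne, zero_add, Matrix.single_apply]
        rw [if_neg]
        rintro ⟨rfl, rfl⟩
        exact absurd hpq (not_lt.2 hle)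
      · intro hall
        by_contra hlt
        have := hall i j (not_le.1 hlt)
        rw [Matrix.add_apply, Matrix.one_apply_ne hij, zero_add, Matrix.single_apply_same] at this
        exact one_ne_zero this
    rw [h1, ← act_toBoundary_eq_iff hn hδ, h]
    constructor
    · intro heq
      have h2 : ((g * T * g⁻¹ : G n) : Mat n) *ᵥ a ∈ Submodule.span ℂ {a} := by
        rw [← heq]
        exact ⟨a, Submodule.mem_span_singleton_self a, Matrix.toLin'_apply _ _⟩
      obtain ⟨c, hc⟩ := Submodule.mem_span_singleton.1 h2
      have h3 : c • w = w + Pi.single i (w j) := by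
        rw [← hTw, ← inv_mulVec_coe_mulVec g ((T : Mat n) *ᵥ w), ← hka, ← hc,
          Matrix.mulVec_smul]
      -- If w_j ≠ 0, coordinate j forces c = 1, and then coordinate i reads w_i = w_i + w_j.
      by_contra hne
      have h4 := congrFun h3 j
      have h5 := congrFun h3 i
      simp only [Pi.smul_apply, Pi.add_apply, smul_eq_mul, Pi.single_eq_same,
        Pi.single_eq_of_ne hij.symm, add_zero] at h4 h5
      have h6 : c = 1 := mul_right_cancel₀ hne (by rw [h4, one_mul])
      rw [h6, one_mul] at h5
      exact hne (left_eq_add.1 h5)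
    · intro h0
      apply map_toLin'_eq_of_le
      rw [Submodule.map_span, Set.image_singleton, Matrix.toLin'_apply, hka, hTw, h0,
        Pi.single_zero, add_zero, hgw]
  have : Nonempty (Fin n) := ⟨⟨0, by omega⟩⟩
  -- At a maximal index i₀ the key equivalence kills all other coordinates of w. Hence w_{i₀} ≠ 0,
  -- so the maximum is strict, and the vanishing of the others makes the remaining x_i equal to each
  -- other.
  obtain ⟨i₀, hi₀⟩ := Finite.exists_max x
  have hz : ∀ i, i ≠ i₀ → w i = 0 := fun i hi => (key i₀ i hi.symm).1 (hi₀ i)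
  have hw1 : w i₀ ≠ 0 := fun h0 => hw0 <| by
    ext i
    by_cases hi : i = i₀
    · rw [hi, h0]; rfl
    · exact hz i hi
  have : Nontrivial (Fin n) := Fin.nontrivial_iff_two_le.2 hn
  obtain ⟨j, hj⟩ := exists_ne i₀
  refine ⟨i₀, hz, x j, ?_, fun i hi => ?_⟩
  · exact not_le.1 fun hle => hw1 ((key j i₀ hj).1 hle)
  · by_cases hij : i = j
    · rw [hij]
    · exact le_antisymm ((key j i (Ne.symm hij)).2 (hz i hi)) ((key i j hij).2 (hz j hj))

/-! ### Gates as critical points -/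

/-- The function on `Z` which sends `gK` to the squared norm of `g⁻¹ a`. -/
noncomputable def invNsq (a : Fin n → ℂ) (z : Z n) : ℝ :=
  nsq ((((Quotient.out z : G n)⁻¹ : G n) : Mat n) *ᵥ a)

theorem invNsq_mk (a : Fin n → ℂ) (g : G n) :
    invNsq a (QuotientGroup.mk g) = nsq (((g⁻¹ : G n) : Mat n) *ᵥ a) :=
  nsq_inv_mulVec_congr (QuotientGroup.out_eq' _) a

theorem invNsq_geod_pDiag (a : Fin n → ℂ) (g : G n) (x : Fin n → ℝ) (hx : ∑ i, x i = 0) (t : ℝ) :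
    invNsq a (geod g (pDiag x hx) t)
      = ∑ i, Real.exp (-2 * t * x i) * ‖(((g⁻¹ : G n) : Mat n) *ᵥ a) i‖ ^ 2 := by
  rw [geod, invNsq_mk, mul_inv_rev, inv_expG_pDiag, Matrix.SpecialLinearGroup.coe_mul,
    ← Matrix.mulVec_mulVec, coe_expG_pDiag, nsq]
  refine Finset.sum_congr rfl fun i _ => ?_
  rw [realDiag_mulVec, norm_mul, mul_pow, Complex.norm_real, Real.norm_of_nonneg
    (Real.exp_pos _).le, ← Real.exp_nat_mul]
  congr 2
  push_cast
  ring

theorem hasDerivAt_invNsq_geod_pDiag (a : Fin n → ℂ) (g : G n) (x : Fin n → ℝ)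
    (hx : ∑ i, x i = 0) (t : ℝ) :
    HasDerivAt (fun t => invNsq a (geod g (pDiag x hx) t))
      (∑ i, Real.exp (-2 * t * x i) * (-2 * x i) * ‖(((g⁻¹ : G n) : Mat n) *ᵥ a) i‖ ^ 2) t := by
  simp only [invNsq_geod_pDiag]
  refine HasDerivAt.fun_sum fun i _ => HasDerivAt.mul_const ?_ _
  have h := (((hasDerivAt_id t).const_mul (-2 : ℝ)).mul_const (x i)).exp
  simpa using h

theorem inv_mul_mulVec_of_mem_K {k : G n} (hk : k ∈ K n) (g : G n) (a : Fin n → ℂ) :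
    (((g * k)⁻¹ : G n) : Mat n) *ᵥ a = (k : Mat n)ᴴ *ᵥ (((g⁻¹ : G n) : Mat n) *ᵥ a) := by
  rw [mul_inv_rev, Matrix.SpecialLinearGroup.coe_mul, coe_inv_of_mem_K hk, Matrix.mulVec_mulVec]

theorem star_dotProduct_conj_mulVec (A B : Mat n) (w : Fin n → ℂ) :
    star w ⬝ᵥ (A * B * Aᴴ) *ᵥ w = star (Aᴴ *ᵥ w) ⬝ᵥ B *ᵥ (Aᴴ *ᵥ w) := by
  rw [Matrix.star_mulVec, Matrix.conjTranspose_conjTranspose, ← Matrix.dotProduct_mulVec,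
    Matrix.mulVec_mulVec, Matrix.mulVec_mulVec, Matrix.mul_assoc]

theorem star_dotProduct_realDiag_mulVec (x : Fin n → ℝ) (u : Fin n → ℂ) :
    (star u ⬝ᵥ realDiag x *ᵥ u).re = ∑ i, x i * ‖u i‖ ^ 2 := by
  have : star u ⬝ᵥ realDiag x *ᵥ u = ((∑ i, x i * ‖u i‖ ^ 2 : ℝ) : ℂ) := by
    rw [dotProduct]
    push_cast
    refine Finset.sum_congr rfl fun i _ => ?_
    rw [realDiag_mulVec, ← Complex.conj_mul']
    simp only [Pi.star_apply, RCLike.star_def]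
    ring
  rw [this, Complex.ofReal_re]

/-- Computed in a diagonalizing frame, where the function is a sum of exponentials, but stated
without the frame so that it can be compared with the Killing product in `sq_norm_mul_killing`. -/
theorem hasDerivAt_invNsq_geod (hn : 0 < n) (a : Fin n → ℂ) (g : G n) (X : pSpace n) :
    HasDerivAt (fun t => invNsq a (geod g X t))
      (-2 * (star (((g⁻¹ : G n) : Mat n) *ᵥ a) ⬝ᵥ (X : Mat n) *ᵥ (((g⁻¹ : G n) : Mat n) *ᵥ a)).re)
      0 := by
  obtain ⟨k, hk, x, hx, hX⟩ := exists_diagonal_direction hn X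
  have h := hasDerivAt_invNsq_geod_pDiag a (g * k) x hx 0
  simp only [geod_conj hk hX]
  convert h using 1
  rw [hX, star_dotProduct_conj_mulVec, coe_pDiag, star_dotProduct_realDiag_mulVec, Finset.mul_sum]
  refine Finset.sum_congr rfl fun i _ => ?_
  rw [inv_mul_mulVec_of_mem_K hk, mul_zero, zero_mul, Real.exp_zero]
  ring

/-- Up to the scalar matrix μ, which is invisible to the traceless X, the matrix k diag(y) kᴴ is (y
i₀ - μ) times the orthogonal projector onto the line of w. Orthogonality to X thus amounts to the
vanishing of Re w*Xw. -/
theorem sq_norm_mul_killing {k : G n} (hk : k ∈ K n) (X : pSpace n) {y : Fin n → ℝ} {i₀ : Fin n}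
    {μ : ℝ} (hy : ∀ i, i ≠ i₀ → y i = μ) {w : Fin n → ℂ} {c : ℂ}
    (hw : (k : Mat n)ᴴ *ᵥ w = Pi.single i₀ c) :
    ‖c‖ ^ 2 * killing (X : Mat n) ((k : Mat n) * realDiag y * (k : Mat n)ᴴ)
      = 4 * n * (y i₀ - μ) * (star w ⬝ᵥ (X : Mat n) *ᵥ w).re := by
  set B := (k : Mat n)ᴴ * (X : Mat n) * (k : Mat n) with hB
  have hX : (X : Mat n) = (k : Mat n) * B * (k : Mat n)ᴴ := by
    rw [hB, show (k : Mat n) * ((k : Mat n)ᴴ * (X : Mat n) * (k : Mat n)) * (k : Mat n)ᴴ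
      = ((k : Mat n) * (k : Mat n)ᴴ) * (X : Mat n) * ((k : Mat n) * (k : Mat n)ᴴ) by
        simp only [Matrix.mul_assoc], mem_K_iff.1 hk, Matrix.one_mul, Matrix.mul_one]
  have htr : B.trace = 0 := by
    rw [hB, Matrix.trace_mul_comm, ← Matrix.mul_assoc, mem_K_iff.1 hk, Matrix.one_mul]
    exact X.2.2
  have h1 : (star w ⬝ᵥ (X : Mat n) *ᵥ w).re = ‖c‖ ^ 2 * (B i₀ i₀).re := by
    rw [hX, star_dotProduct_conj_mulVec, hw]
    have : star (Pi.single i₀ c : Fin n → ℂ) ⬝ᵥ B *ᵥ Pi.single i₀ c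
        = ((‖c‖ ^ 2 : ℝ) : ℂ) * B i₀ i₀ := by
      rw [Pi.star_single, single_dotProduct, Matrix.mulVec_single]
      push_cast
      rw [← Complex.conj_mul']
      simp
      ring
    rw [this, Complex.re_ofReal_mul]
  have h2 : (B * realDiag y).trace = ((y i₀ - μ : ℝ) : ℂ) * B i₀ i₀ := by
    have e : (B * realDiag y).trace - (μ : ℂ) * B.trace = ((y i₀ - μ : ℝ) : ℂ) * B i₀ i₀ := by
      rw [Matrix.trace, Matrix.trace, Finset.mul_sum, ← Finset.sum_sub_distrib,
        Finset.sum_eq_single i₀]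
      · simp only [realDiag, Matrix.diag_apply, Matrix.mul_diagonal]
        push_cast
        ring
      · intro i _ hi
        simp only [realDiag, Matrix.diag_apply, Matrix.mul_diagonal, hy i hi]
        ring
      · simp
    rwa [htr, mul_zero, sub_zero] at e
  rw [h1]
  conv_lhs => rw [hX]
  rw [killing_conj hk, killing, h2, Complex.re_ofReal_mul]
  ring

/-- The columns of V form an orthonormal basis whose member at i₀ is w/‖w‖. -/
theorem exists_unitary_conjTranspose_mulVec_eq_single (i₀ : Fin n) {w : Fin n → ℂ} (hw : w ≠ 0) :
    ∃ V : Mat n, V * Vᴴ = 1 ∧ ∃ c : ℂ, c ≠ 0 ∧ Vᴴ *ᵥ w = Pi.single i₀ c := by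
  let w' : EuclideanSpace ℂ (Fin n) := WithLp.toLp 2 w
  have hw' : w' ≠ 0 := fun h => hw (by simpa [w'] using h)
  have hn0 : (‖w'‖ : ℂ) ≠ 0 := by exact_mod_cast norm_ne_zero_iff.2 hw'
  have ho : Orthonormal ℂ (({i₀} : Set (Fin n)).domRestrict
      fun _ => ((‖w'‖ : ℂ)⁻¹ • w' : EuclideanSpace ℂ (Fin n))) := by
    constructor
    · intro i
      simp only [Set.domRestrict_apply, norm_smul, norm_inv, Complex.norm_real, norm_norm]
      exact inv_mul_cancel₀ (norm_ne_zero_iff.2 hw')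
    · intro i j hij
      exact absurd (Subsingleton.elim i j) hij
  obtain ⟨b, hb⟩ := ho.exists_orthonormalBasis_extension_of_card_eq (by simp)
  have hbi := hb i₀ rfl
  have hwb : w' = (‖w'‖ : ℂ) • b i₀ := by
    rw [hbi, smul_smul, mul_inv_cancel₀ hn0, one_smul]
  let V : Mat n := Matrix.of fun i j => b j i
  have hV : Vᴴ * V = 1 := by
    ext i j
    rw [Matrix.mul_apply, Matrix.one_apply, ← orthonormal_iff_ite.1 b.orthonormal i j,
      PiLp.inner_apply]
    exact Finset.sum_congr rfl fun l _ => by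
      simp [V, mul_comm]
  refine ⟨V, mul_eq_one_comm.1 hV, (‖w'‖ : ℂ), hn0, ?_⟩
  have hwV : w = V *ᵥ Pi.single i₀ (‖w'‖ : ℂ) := by
    ext i
    have h1 := congrFun (congrArg WithLp.ofLp hwb) i
    rw [Matrix.mulVec_single]
    simpa [V, w', mul_comm] using h1
  conv_lhs => rw [hwV]
  rw [Matrix.mulVec_mulVec, hV, Matrix.one_mulVec]

/-- The traceless vector with entry `(n - 1) ρ` at `i₀` and entries `-ρ` elsewhere. -/
noncomputable def spike (i₀ : Fin n) (ρ : ℝ) : Fin n → ℝ :=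
  fun i => if i = i₀ then ((n : ℝ) - 1) * ρ else -ρ

theorem spike_self (i₀ : Fin n) (ρ : ℝ) : spike i₀ ρ i₀ = ((n : ℝ) - 1) * ρ := if_pos rfl

theorem spike_of_ne {i₀ i : Fin n} (h : i ≠ i₀) (ρ : ℝ) : spike i₀ ρ i = -ρ := if_neg h

theorem card_erase_univ (i₀ : Fin n) : ((Finset.univ.erase i₀).card : ℝ) = (n : ℝ) - 1 := by
  rw [Finset.card_erase_of_mem (Finset.mem_univ _), Finset.card_univ, Fintype.card_fin,
    Nat.cast_sub (by have := i₀.2; omega), Nat.cast_one]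

theorem sum_spike (i₀ : Fin n) (ρ : ℝ) : ∑ i, spike i₀ ρ i = 0 := by
  rw [← Finset.add_sum_erase _ _ (Finset.mem_univ i₀), spike_self,
    Finset.sum_congr rfl fun i hi => spike_of_ne (Finset.ne_of_mem_erase hi) ρ,
    Finset.sum_const, nsmul_eq_mul, card_erase_univ]
  ring

/-- The entry `ρ` for which the diagonal direction `spike i₀ ρ` has unit length. -/
noncomputable def unitEntry (n : ℕ) : ℝ := 1 / (2 * n * √((n : ℝ) - 1))

theorem sqrt_sub_one_pos (hn : 2 ≤ n) : 0 < √((n : ℝ) - 1) := by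
  have : (2 : ℝ) ≤ n := by exact_mod_cast hn
  exact Real.sqrt_pos.2 (by linarith)

theorem sqrt_sub_one_sq (hn : 2 ≤ n) : √((n : ℝ) - 1) ^ 2 = (n : ℝ) - 1 := by
  have : (2 : ℝ) ≤ n := by exact_mod_cast hn
  exact Real.sq_sqrt (by linarith)

theorem unitEntry_pos (hn : 2 ≤ n) : 0 < unitEntry n := by
  have := sqrt_sub_one_pos hn
  have : (0 : ℝ) < n := by positivity
  unfold unitEntry
  positivity

theorem killing_spike (i₀ : Fin n) (ρ : ℝ) :
    killing (realDiag (spike i₀ ρ)) (realDiag (spike i₀ ρ)) = 4 * n ^ 2 * (n - 1) * ρ ^ 2 := by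
  rw [killing_realDiag, ← Finset.add_sum_erase _ _ (Finset.mem_univ i₀), spike_self,
    Finset.sum_congr rfl fun i hi => by rw [spike_of_ne (Finset.ne_of_mem_erase hi) ρ],
    Finset.sum_const, nsmul_eq_mul, card_erase_univ]
  ring

theorem four_mul_unitEntry_sq (hn : 2 ≤ n) :
    4 * (n : ℝ) ^ 2 * ((n : ℝ) - 1) * unitEntry n ^ 2 = 1 := by
  have h1 := sqrt_sub_one_pos hn
  have h2 : (0 : ℝ) < n := by positivity
  rw [← sqrt_sub_one_sq hn, unitEntry]
  field_simp
  ring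

theorem killing_spike_unitEntry (hn : 2 ≤ n) (i₀ : Fin n) :
    killing (realDiag (spike i₀ (unitEntry n))) (realDiag (spike i₀ (unitEntry n))) = 1 := by
  rw [killing_spike, four_mul_unitEntry_sq hn]

theorem spike_lt_spike_iff (hn : 2 ≤ n) {i₀ : Fin n} {ρ : ℝ} (hρ : 0 < ρ) (i j : Fin n) :
    spike i₀ ρ i < spike i₀ ρ j ↔ ¬ i = i₀ ∧ j = i₀ := by
  have hn' : (2 : ℝ) ≤ n := by exact_mod_cast hn
  have : -ρ < ((n : ℝ) - 1) * ρ := by nlinarith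
  unfold spike
  split_ifs with h1 h2 h2 <;> simp [h1, h2, this, this.le]

theorem mem_span_singleton_iff_of_inv_mulVec {g : G n} {a : Fin n → ℂ} {i₀ : Fin n} {c : ℂ}
    (hc : c ≠ 0) (ha : ((g⁻¹ : G n) : Mat n) *ᵥ a = Pi.single i₀ c) (v : Fin n → ℂ) :
    v ∈ Submodule.span ℂ {a} ↔ ∀ i, ¬ i = i₀ → (((g⁻¹ : G n) : Mat n) *ᵥ v) i = 0 := by
  rw [Submodule.mem_span_singleton]
  constructor
  · rintro ⟨d, rfl⟩ i hi
    rw [Matrix.mulVec_smul, ha, Pi.smul_apply, Pi.single_eq_of_ne hi, smul_zero]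
  · intro h
    refine ⟨(((g⁻¹ : G n) : Mat n) *ᵥ v) i₀ / c, ?_⟩
    rw [← coe_mulVec_inv_mulVec g v, ← coe_mulVec_inv_mulVec g a, ha, ← Matrix.mulVec_smul,
      inv_mulVec_coe_mulVec]
    congr 1
    ext i
    by_cases hi : i = i₀
    · subst hi
      simp [div_mul_cancel₀ _ hc]
    · rw [h i hi, Pi.smul_apply, Pi.single_eq_of_ne hi, smul_zero]

/-- The gates of the boundary point of a line `⟨a⟩` on a geodesic are the critical points of
`gK ↦ |g⁻¹ a|²`. -/
theorem isGate_span_iff (hn : 2 ≤ n) {γ : ℝ → Z n}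
    (hγ : ∀ s, ∃ (g : G n) (X : pSpace n), ∀ t, γ (s + t) = geod g X t) {a : Fin n → ℂ}
    (ha : a ≠ 0) (x : Z n) :
    IsGate γ (Submodule.span ℂ {a}) x ↔
      ∃ s, γ s = x ∧ HasDerivAt (fun t => invNsq a (γ t)) 0 s := by
  have hn0 : 0 < n := by omega
  -- `MeetsAtRightAngle` describes γ from γ(s) on, so critical points are moved to time 0.
  have hshift : ∀ {s d : ℝ}, HasDerivAt (fun t => invNsq a (γ t)) d s ↔
      HasDerivAt (fun t => invNsq a (γ (s + t))) d 0 := fun {s d} => by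
    constructor
    · intro h
      exact HasDerivAt.comp_const_add (f := fun t => invNsq a (γ t)) s 0 (by rwa [add_zero])
    · intro h
      have := HasDerivAt.comp_const_add (f := fun t => invNsq a (γ (s + t))) (-s) s
        (by rwa [neg_add_cancel])
      simpa using this
  refine exists_congr fun s => and_congr_right fun hs => ?_
  constructor
  · rintro ⟨δ, -, hδA, g, X, Y, hX, hY, hXY⟩
    obtain ⟨k, hk, y, hy, hYk⟩ := exists_diagonal_direction hn0 Y
    have hδ : ∀ t : ℝ≥0, δ.toFun t = geod (g * k) (pDiag y hy) t := fun t => by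
      rw [hY, geod_conj hk hYk]
    obtain ⟨i₀, hi₀, μ, hμ, hyμ⟩ := direction_of_isBoundaryPointOf_span hn hδ ha hδA
    set w := ((g⁻¹ : G n) : Mat n) *ᵥ a with hw
    have hkw : (k : Mat n)ᴴ *ᵥ w = Pi.single i₀ (((k : Mat n)ᴴ *ᵥ w) i₀) := by
      ext i
      by_cases hi : i = i₀
      · rw [hi, Pi.single_eq_same]
      · rw [Pi.single_eq_of_ne hi, ← hi₀ i hi, inv_mul_mulVec_of_mem_K hk]
    have hkey := sq_norm_mul_killing hk X hyμ hkw
    rw [coe_pDiag] at hYk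
    rw [← hYk, hXY, mul_zero] at hkey
    have h0 : (star w ⬝ᵥ (X : Mat n) *ᵥ w).re = 0 := by
      have hpos : 0 < 4 * (n : ℝ) * (y i₀ - μ) := by
        have : 0 < y i₀ - μ := sub_pos.2 hμ
        positivity
      exact (mul_eq_zero.1 hkey.symm).resolve_left hpos.ne'
    have hd := hasDerivAt_invNsq_geod hn0 a g X
    rw [← hw, h0, mul_zero] at hd
    rw [hshift]
    simpa only [hX] using hd
  · intro hd
    obtain ⟨g, X, hX⟩ := hγ s
    set w := ((g⁻¹ : G n) : Mat n) *ᵥ a with hw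
    have hw0 : w ≠ 0 := inv_mulVec_ne_zero g ha
    -- Conversely a ray has to be produced: the unit spike direction, at an arbitrary index, rotated
    -- by k so that its top eigenvector is w. Its stabilizer identifies its end as the boundary
    -- point of the line of a.
    let i₀ : Fin n := ⟨0, hn0⟩
    obtain ⟨V, hV, c, hc, hVw⟩ := exists_unitary_conjTranspose_mulVec_eq_single i₀ hw0
    obtain ⟨k, hk, ζ, hζ, hkV⟩ := exists_mem_K_eq_smul hn0 hV
    have hkw : (k : Mat n)ᴴ *ᵥ w = Pi.single i₀ (star ζ * c) := by
      rw [hkV, Matrix.conjTranspose_smul, Matrix.smul_mulVec, hVw, ← Pi.single_smul', smul_eq_mul]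
    have hc' : star ζ * c ≠ 0 := mul_ne_zero (right_ne_zero_of_mul_eq_one hζ) hc
    let D := pDiag (spike i₀ (unitEntry n)) (sum_spike _ _)
    have hYmem : (k : Mat n) * (D : Mat n) * (k : Mat n)ᴴ ∈ pSpace n := by
      refine ⟨Matrix.isHermitian_mul_mul_conjTranspose _ D.2.1, ?_⟩
      rw [Matrix.trace_mul_comm, ← Matrix.mul_assoc, conjTranspose_mul_of_mem_K hk,
        Matrix.one_mul]
      exact D.2.2
    let Y : pSpace n := ⟨_, hYmem⟩
    let δ : Ray n := ⟨fun t => geod g Y t, g, Y, by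
      change killing ((k : Mat n) * (D : Mat n) * (k : Mat n)ᴴ) _ = 1
      rw [killing_conj hk]
      exact killing_spike_unitEntry hn i₀, fun _ => rfl⟩
    refine ⟨δ, ?_, ?_, g, X, Y, hX, fun _ => rfl, ?_⟩
    · have h1 := hX 0
      rw [add_zero, hs] at h1
      rw [h1]
      change geod g Y ((0 : ℝ≥0) : ℝ) = geod g X 0
      simp [geod]
    · have hδ : ∀ t : ℝ≥0, δ.toFun t = geod (g * k) D t := fun t => geod_conj hk rfl g t
      refine isBoundaryPointOf_of_two_valued hn hδ
        (fun i j => spike_lt_spike_iff hn (unitEntry_pos hn) i j)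
        (mem_span_singleton_iff_of_inv_mulVec hc' ?_)
      rw [inv_mul_mulVec_of_mem_K hk, ← hw, hkw]
    · rw [hshift] at hd
      simp only [hX] at hd
      have h0 := hd.unique (hasDerivAt_invNsq_geod hn0 a g X)
      have hkey := sq_norm_mul_killing hk X (y := spike i₀ (unitEntry n))
        (fun i hi => spike_of_ne hi _) hkw
      have h1 : (star w ⬝ᵥ (X : Mat n) *ᵥ w).re = 0 := by linarith
      rw [h1, mul_zero] at hkey
      exact (mul_eq_zero.1 hkey).resolve_left (pow_ne_zero _ (norm_ne_zero_iff.2 hc'))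

/-! ### Distances and gates along a spike geodesic -/

theorem geod_pDiag_add (g : G n) (x : Fin n → ℝ) (hx : ∑ i, x i = 0) (s t : ℝ) :
    geod g (pDiag x hx) (s + t) = geod (g * expG (s • pDiag x hx)) (pDiag x hx) t := by
  rw [geod, expG_pDiag_add, geod, mul_assoc]

/-- The length of the segment bounds the distance above. Below, log|(·)ᴴv|² is used with v chosen so
that gᴴv = e_{i₀}: it grows linearly along the geodesic at rate 2(n-1)ρ = √(n-1)/n, exactly its
Lipschitz constant. -/
theorem zDist_geod_spike (hn : 2 ≤ n) (g : G n) (i₀ : Fin n) (s t : ℝ) :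
    zDist (geod g (pDiag (spike i₀ (unitEntry n)) (sum_spike _ _)) s)
      (geod g (pDiag (spike i₀ (unitEntry n)) (sum_spike _ _)) t) = |t - s| := by
  set D := pDiag (spike i₀ (unitEntry n)) (sum_spike _ _) with hD
  have hnp : (0 : ℝ) < n := by positivity
  have hsq := sqrt_sub_one_pos hn
  have hle : zEDist (geod g D s) (geod g D t) ≤ ENNReal.ofReal |t - s| := by
    have := zEDist_geod_le (by omega) g D s t
    rwa [hD, coe_pDiag, killing_spike_unitEntry hn, Real.sqrt_one, mul_one] at this
  let v : Fin n → ℂ := ((g⁻¹ : G n) : Mat n)ᴴ *ᵥ Pi.single i₀ 1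
  have hgv : (g : Mat n)ᴴ *ᵥ v = Pi.single i₀ 1 := by
    rw [Matrix.mulVec_mulVec, ← Matrix.conjTranspose_mul, coe_inv_mul_coe,
      Matrix.conjTranspose_one, Matrix.one_mulVec]
  have hv : v ≠ 0 := fun h => by
    rw [h, Matrix.mulVec_zero] at hgv
    simpa using congrFun hgv i₀
  have hval : ∀ τ : ℝ, Real.log (nsq (((g * expG (τ • D) : G n) : Mat n)ᴴ *ᵥ v))
      = 2 * (τ * (((n : ℝ) - 1) * unitEntry n)) := by
    intro τ
    rw [Matrix.SpecialLinearGroup.coe_mul, Matrix.conjTranspose_mul, ← Matrix.mulVec_mulVec, hgv,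
      hD, coe_expG_pDiag, conjTranspose_realDiag, nsq, Finset.sum_eq_single i₀]
    · rw [realDiag_mulVec, Pi.single_eq_same, mul_one, Complex.norm_real,
        Real.norm_of_nonneg (Real.exp_pos _).le, Real.log_pow, Real.log_exp, spike_self]
      norm_num
    · intro i _ hi
      rw [realDiag_mulVec, Pi.single_eq_of_ne hi]
      simp
    · simp
  have hge := ofReal_abs_log_nsq_sub_le hn (g * expG (s • D)) (g * expG (t • D)) hv
  rw [hval, hval] at hge
  have hκ : 2 * (((n : ℝ) - 1) * unitEntry n) = √((n : ℝ) - 1) / n := by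
    rw [unitEntry]
    field_simp
    linarith [sqrt_sub_one_sq hn]
  have habs : |2 * (t * (((n : ℝ) - 1) * unitEntry n)) - 2 * (s * (((n : ℝ) - 1) * unitEntry n))|
      = √((n : ℝ) - 1) / n * |t - s| := by
    rw [← hκ, show 2 * (t * (((n : ℝ) - 1) * unitEntry n))
      - 2 * (s * (((n : ℝ) - 1) * unitEntry n)) = 2 * (((n : ℝ) - 1) * unitEntry n) * (t - s) by
        ring, abs_mul, abs_of_nonneg (a := 2 * (((n : ℝ) - 1) * unitEntry n))]
    rw [hκ]; positivity
  have hκ0 : 0 < √((n : ℝ) - 1) / n := by positivity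
  rw [habs, ENNReal.ofReal_mul hκ0.le] at hge
  have hge' := (ENNReal.mul_le_mul_iff_right (ENNReal.ofReal_pos.2 hκ0).ne'
    ENNReal.ofReal_ne_top).1 hge
  rw [zDist, le_antisymm hle hge', ENNReal.toReal_ofReal (abs_nonneg _)]

/-- Distances show that γ is injective, so the parameters in the definition of `distor` can only be
s and t. -/
theorem distor_geod_spike (hn : 2 ≤ n) {γ : ℝ → Z n} {g : G n} {i₀ : Fin n}
    (hγ : ∀ t, γ t = geod g (pDiag (spike i₀ (unitEntry n)) (sum_spike _ _)) t) (s t : ℝ) :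
    distor γ (γ s) (γ t) = t - s := by
  have hd : ∀ s t, zDist (γ s) (γ t) = |t - s| := fun s t => by
    rw [hγ, hγ, zDist_geod_spike hn]
  have hinj : ∀ s t, γ s = γ t → s = t := fun s t h => by
    have h1 := hd s t
    rw [← h, hd s s, sub_self, abs_zero] at h1
    linarith [abs_eq_zero.1 h1.symm]
  rw [distor, hd]
  split_ifs with h
  · obtain ⟨s', t', hst, hs, ht⟩ := h
    rw [hinj _ _ hs, hinj _ _ ht] at hst
    exact abs_of_nonneg (sub_nonneg.2 hst)
  · have hts : t < s := by
      by_contra hle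
      exact h ⟨s, t, not_lt.1 hle, rfl, rfl⟩
    rw [abs_of_neg (sub_neg.2 hts), neg_neg]

/-- The time at which a geodesic of direction `spike i₀ ρ` of unit speed from `gK` passes through
the gate of the line spanned by `g w`. -/
noncomputable def gateTime (i₀ : Fin n) (w : Fin n → ℂ) : ℝ :=
  √((n : ℝ) - 1) *
    Real.log (((n : ℝ) - 1) * (‖w i₀‖ ^ 2 / ∑ i ∈ Finset.univ.erase i₀, ‖w i‖ ^ 2))

theorem isGate_geod_spike_iff (hn : 2 ≤ n) {γ : ℝ → Z n} {g : G n} {i₀ : Fin n}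
    (hγ : ∀ t, γ t = geod g (pDiag (spike i₀ (unitEntry n)) (sum_spike _ _)) t)
    {a : Fin n → ℂ} (ha : (((g⁻¹ : G n) : Mat n) *ᵥ a) i₀ ≠ 0)
    (ha' : ∃ i, i ≠ i₀ ∧ (((g⁻¹ : G n) : Mat n) *ᵥ a) i ≠ 0) (x : Z n) :
    IsGate γ (Submodule.span ℂ {a}) x ↔ x = γ (gateTime i₀ (((g⁻¹ : G n) : Mat n) *ᵥ a)) := by
  have ha0 : a ≠ 0 := by
    rintro rfl
    simp at ha
  set w := ((g⁻¹ : G n) : Mat n) *ᵥ a with hw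
  set ρ := unitEntry n with hρ
  have hn' : (2 : ℝ) ≤ n := by exact_mod_cast hn
  have hρ0 : 0 < ρ := unitEntry_pos hn
  rw [isGate_span_iff hn (fun s => ⟨_, _, fun t => by rw [hγ, geod_pDiag_add]⟩) ha0]
  set q := ‖w i₀‖ ^ 2 with hq
  set S := ∑ i ∈ Finset.univ.erase i₀, ‖w i‖ ^ 2 with hS
  have hq0 : 0 < q := pow_pos (norm_pos_iff.2 ha) 2
  have hS0 : 0 < S := by
    obtain ⟨i, hi, hwi⟩ := ha'
    exact Finset.sum_pos' (fun _ _ => sq_nonneg _)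
      ⟨i, Finset.mem_erase.2 ⟨hi, Finset.mem_univ _⟩, pow_pos (norm_pos_iff.2 hwi) 2⟩
  -- The derivative vanishes iff exp(2snρ) = (n-1)q/S, where q, S > 0, and 2nρ = 1/√(n-1).
  have hcrit : ∀ s, HasDerivAt (fun t => invNsq a (γ t)) 0 s ↔ s = gateTime i₀ w := by
    intro s
    have h1 : HasDerivAt (fun t => invNsq a (γ t))
        (2 * ρ * Real.exp (2 * s * ρ) * S
          - 2 * ρ * (((n : ℝ) - 1) * (Real.exp (-2 * s * (((n : ℝ) - 1) * ρ)) * q))) s := by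
      have h := hasDerivAt_invNsq_geod_pDiag a g (spike i₀ ρ) (sum_spike _ _) s
      simp only [← hγ] at h
      convert h using 1
      rw [← Finset.add_sum_erase _ _ (Finset.mem_univ i₀), spike_self, ← hw, ← hq, hS,
        Finset.mul_sum, sub_eq_neg_add]
      congr 1
      · ring
      · refine Finset.sum_congr rfl fun i hi => ?_
        rw [spike_of_ne (Finset.ne_of_mem_erase hi), show -2 * s * -ρ = 2 * s * ρ by ring]
        ring
    have h2 : HasDerivAt (fun t => invNsq a (γ t)) 0 s ↔
        Real.exp (2 * s * ρ) * S
          = ((n : ℝ) - 1) * (Real.exp (-2 * s * (((n : ℝ) - 1) * ρ)) * q) := by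
      constructor
      · intro h
        have := h.unique h1
        have h3 : 2 * ρ * (Real.exp (2 * s * ρ) * S
          - ((n : ℝ) - 1) * (Real.exp (-2 * s * (((n : ℝ) - 1) * ρ)) * q)) = 0 := by linarith
        have := (mul_eq_zero.1 h3).resolve_left (by positivity)
        linarith
      · intro h
        convert h1 using 1
        rw [← h]
        ring
    have hlog : 2 * s * (n * ρ) = Real.log (((n : ℝ) - 1) * (q / S)) ↔ s = gateTime i₀ w := by
      have hsq := sqrt_sub_one_pos hn
      have hnp : (0 : ℝ) < n := by linarith
      have : 2 * s * (n * ρ) = s / √((n : ℝ) - 1) := by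
        rw [hρ, unitEntry]; field_simp
      rw [this, div_eq_iff hsq.ne', gateTime, mul_comm]
    rw [h2, ← hlog]
    have hpos : 0 < ((n : ℝ) - 1) * (q / S) :=
      mul_pos (by linarith) (div_pos hq0 hS0)
    rw [← Real.exp_eq_exp (x := 2 * s * (n * ρ)), Real.exp_log hpos,
      show 2 * s * (n * ρ) = 2 * s * ρ - (-2 * s * (((n : ℝ) - 1) * ρ)) by ring, Real.exp_sub,
      mul_div_assoc', div_eq_div_iff (Real.exp_pos _).ne' hS0.ne']
    constructor <;> intro h <;> linarith
  simp only [hcrit]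
  constructor
  · rintro ⟨s, hs, rfl⟩
    exact hs.symm
  · intro h
    exact ⟨_, h.symm, rfl⟩

/-! ### Orthonormal bases and orthogonal sums -/

section HermitianMetric

variable {V : Type*} [AddCommGroup V] [Module ℂ V]

theorem HermitianMetric.ext {h h' : HermitianMetric V} (H : ∀ x y, h.inner x y = h'.inner x y) :
    h = h' := by
  obtain ⟨⟨⟨f⟩, _, _, _, _⟩, _⟩ := h
  obtain ⟨⟨⟨f'⟩, _, _, _, _⟩, _⟩ := h'
  have : f = f' := by
    ext x y
    exact H x y
  subst this
  rfl

theorem metric_zero_left (h : HermitianMetric V) (y : V) : h.inner 0 y = 0 := by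
  simpa using h.smul_left 0 y 0

theorem metric_add_right (h : HermitianMetric V) (x y z : V) :
    h.inner x (y + z) = h.inner x y + h.inner x z := by
  rw [← h.conj_inner_symm, h.add_left, map_add, h.conj_inner_symm, h.conj_inner_symm]

theorem metric_smul_right (h : HermitianMetric V) (x y : V) (c : ℂ) :
    h.inner x (c • y) = c * h.inner x y := by
  rw [← h.conj_inner_symm, h.smul_left, map_mul, h.conj_inner_symm, Complex.conj_conj]

theorem metric_zero_right (h : HermitianMetric V) (x : V) : h.inner x 0 = 0 := by
  simpa using metric_smul_right h x 0 0

theorem metric_self_eq_sum {ι : Type*} [Fintype ι] [DecidableEq ι] (h : HermitianMetric V)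
    {v : ι → V} (hv : ∀ i j, h.inner (v i) (v j) = if i = j then 1 else 0) (c : ι → ℂ) :
    h.inner (∑ i, c i • v i) (∑ i, c i • v i) = ((∑ i, ‖c i‖ ^ 2 : ℝ) : ℂ) := by
  let f : V → V →+ ℂ := fun y => AddMonoidHom.mk' (fun x => h.inner x y) fun a b => h.add_left a b y
  let g : V → V →+ ℂ := fun x => AddMonoidHom.mk' (h.inner x) fun a b => metric_add_right h x a b
  calc h.inner (∑ i, c i • v i) (∑ i, c i • v i)
      = ∑ i, h.inner (c i • v i) (∑ j, c j • v j) :=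
        map_sum (f (∑ j, c j • v j)) (fun i => c i • v i) Finset.univ
    _ = ∑ i, ∑ j, h.inner (c i • v i) (c j • v j) :=
        Finset.sum_congr rfl fun i _ => map_sum (g (c i • v i)) (fun j => c j • v j) Finset.univ
    _ = _ := by
        push_cast
        refine Finset.sum_congr rfl fun i _ => ?_
        simp [h.smul_left, metric_smul_right, hv, Complex.conj_mul']

theorem exists_orthonormal_basis_metric [FiniteDimensional ℂ V] (h : HermitianMetric V)
    {ι : Type*} [Fintype ι] [DecidableEq ι] (hι : Module.finrank ℂ V = Fintype.card ι) :
    ∃ w : Module.Basis ι ℂ V, ∀ i j, h.inner (w i) (w j) = if i = j then 1 else 0 := by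
  let : NormedAddCommGroup V := h.toNormedAddCommGroup
  let : InnerProductSpace ℂ V := InnerProductSpace.ofCore h.toCore
  let b := (stdOrthonormalBasis ℂ V).reindex (Fintype.equivOfCardEq (by simp [hι]) :
    Fin (Module.finrank ℂ V) ≃ ι)
  refine ⟨b.toBasis, fun i j => ?_⟩
  rw [OrthonormalBasis.coe_toBasis]
  exact orthonormal_iff_ite.1 b.orthonormal i j

/-- The orthogonal sum of two hermitian metrics. -/
theorem existsUnique_isOrthogonalSum {W₁ W₂ W : Submodule ℂ V} (hd : Disjoint W₁ W₂)
    (hs : W₁ ⊔ W₂ = W) (h₁ : HermitianMetric W₁) (h₂ : HermitianMetric W₂) :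
    ∃ h : HermitianMetric W, ∀ h', IsOrthogonalSum h₁ h₂ h' ↔ h' = h := by
  have hle₁ : W₁ ≤ W := hs ▸ le_sup_left
  have hle₂ : W₂ ≤ W := hs ▸ le_sup_right
  -- The direct sum identifies W₁ × W₂ with W, and the sum of the two forms is transported along
  -- this isomorphism.
  let f : (W₁ × W₂) →ₗ[ℂ] W := (Submodule.inclusion hle₁).coprod (Submodule.inclusion hle₂)
  have hf : ∀ p, ((f p : W) : V) = p.1 + p.2 := fun p => rfl
  have hbij : Function.Bijective f := by
    constructor
    · rw [← LinearMap.ker_eq_bot, LinearMap.ker_eq_bot']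
      rintro ⟨⟨x, hx⟩, ⟨y, hy⟩⟩ hxy
      have h0 : x + y = 0 := congrArg Subtype.val hxy
      have hx2 : x ∈ W₂ := by
        rw [eq_neg_of_add_eq_zero_left h0]
        exact W₂.neg_mem hy
      have hx0 : x = 0 := Submodule.disjoint_def.1 hd x hx hx2
      have hy0 : y = 0 := by rwa [hx0, zero_add] at h0
      subst hx0 hy0
      rfl
    · rintro ⟨x, hx⟩
      rw [← hs] at hx
      obtain ⟨y, hy, z, hz, rfl⟩ := Submodule.mem_sup.1 hx
      exact ⟨(⟨y, hy⟩, ⟨z, hz⟩), rfl⟩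
  let e := LinearEquiv.ofBijective f hbij
  let h : HermitianMetric W :=
    { inner := fun x y => h₁.inner (e.symm x).1 (e.symm y).1 + h₂.inner (e.symm x).2 (e.symm y).2
      conj_inner_symm := fun x y => by
        rw [map_add, h₁.conj_inner_symm, h₂.conj_inner_symm]
      re_inner_nonneg := fun x => by
        rw [map_add]
        exact add_nonneg (h₁.re_inner_nonneg _) (h₂.re_inner_nonneg _)
      add_left := fun x y z => by
        rw [map_add, Prod.fst_add, Prod.snd_add, h₁.add_left, h₂.add_left]
        ring
      smul_left := fun x y r => by
        rw [map_smul, Prod.smul_fst, Prod.smul_snd, h₁.smul_left, h₂.smul_left]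
        ring
      definite := fun x hx => by
        have hre := congrArg Complex.re hx
        have n1 : 0 ≤ (h₁.inner (e.symm x).1 (e.symm x).1).re := h₁.re_inner_nonneg _
        have n2 : 0 ≤ (h₂.inner (e.symm x).2 (e.symm x).2).re := h₂.re_inner_nonneg _
        rw [Complex.add_re, Complex.zero_re] at hre
        have hz1 : h₁.inner (e.symm x).1 (e.symm x).1 = 0 :=
          Complex.ext (by rw [Complex.zero_re]; linarith)
            (Complex.conj_eq_iff_im.1 (h₁.conj_inner_symm _ _))
        have hz2 : h₂.inner (e.symm x).2 (e.symm x).2 = 0 :=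
          Complex.ext (by rw [Complex.zero_re]; linarith)
            (Complex.conj_eq_iff_im.1 (h₂.conj_inner_symm _ _))
        exact e.symm.map_eq_zero_iff.1 (Prod.ext (h₁.definite _ hz1) (h₂.definite _ hz2)) }
  have he₁ : ∀ x (hx : x ∈ W₁) (hx' : x ∈ W), e.symm ⟨x, hx'⟩ = (⟨x, hx⟩, 0) := fun x hx hx' => by
    rw [LinearEquiv.symm_apply_eq]
    exact Subtype.ext (by simp [e, hf])
  have he₂ : ∀ x (hx : x ∈ W₂) (hx' : x ∈ W), e.symm ⟨x, hx'⟩ = (0, ⟨x, hx⟩) := fun x hx hx' => by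
    rw [LinearEquiv.symm_apply_eq]
    exact Subtype.ext (by simp [e, hf])
  have hh : IsOrthogonalSum h₁ h₂ h :=
    { disjoint := hd
      sup_eq := hs
      inner_left := fun x y hx hy hx' hy' => by
        change h₁.inner _ _ + h₂.inner _ _ = _
        rw [he₁ x hx, he₁ y hy, metric_zero_left, add_zero]
      inner_right := fun x y hx hy hx' hy' => by
        change h₁.inner _ _ + h₂.inner _ _ = _
        rw [he₂ x hx, he₂ y hy, metric_zero_left, zero_add]
      inner_cross := fun x y hx hy hx' hy' => by
        change h₁.inner _ _ + h₂.inner _ _ = _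
        rw [he₁ x hx, he₂ y hy, metric_zero_left, metric_zero_right, add_zero] }
  -- The clauses of an orthogonal sum determine every value; the missing cross term follows by
  -- conjugate symmetry.
  have hval : ∀ h', IsOrthogonalSum h₁ h₂ h' → ∀ p q : W₁ × W₂,
      h'.inner (f p) (f q) = h₁.inner p.1 q.1 + h₂.inner p.2 q.2 := by
    intro h' H p q
    obtain ⟨⟨x, hx⟩, ⟨y, hy⟩⟩ := p
    obtain ⟨⟨z, hz⟩, ⟨w, hw⟩⟩ := q
    have e1 : f (⟨x, hx⟩, ⟨y, hy⟩) = (⟨x, hle₁ hx⟩ : W) + ⟨y, hle₂ hy⟩ := rfl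
    have e2 : f (⟨z, hz⟩, ⟨w, hw⟩) = (⟨z, hle₁ hz⟩ : W) + ⟨w, hle₂ hw⟩ := rfl
    have hyz : h'.inner (⟨y, hle₂ hy⟩ : W) ⟨z, hle₁ hz⟩ = 0 := by
      rw [← h'.conj_inner_symm, H.inner_cross z y hz hy, map_zero]
    rw [e1, e2, h'.add_left, metric_add_right, metric_add_right, H.inner_left x z hx hz,
      H.inner_right y w hy hw, H.inner_cross x w hx hw, hyz]
    ring
  refine ⟨h, fun h' => ⟨fun H => HermitianMetric.ext fun x y => ?_, fun H => H ▸ hh⟩⟩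
  obtain ⟨p, rfl⟩ := hbij.2 x
  obtain ⟨q, rfl⟩ := hbij.2 y
  rw [hval h' H, hval h hh]

end HermitianMetric

/-! ### Levine forms and the intersection number -/

section Functionals

variable {V : Type*} [AddCommGroup V] [Module ℂ V]

/-- The vector ψ(y)x - ψ(x)y lies in the common kernel. This expresses proportionality of φ and ψ
without naming the factor. -/
theorem mul_apply_eq_of_ker_eq {φ ψ : Module.Dual ℂ V}
    (h : LinearMap.ker φ = LinearMap.ker ψ) (x y : V) : ψ x * φ y = φ x * ψ y := by
  have h1 : ψ y • x - ψ x • y ∈ LinearMap.ker φ := by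
    rw [h, LinearMap.mem_ker, map_sub, map_smul, map_smul, smul_eq_mul, smul_eq_mul]
    ring
  rw [LinearMap.mem_ker, map_sub, map_smul, map_smul, smul_eq_mul, smul_eq_mul] at h1
  linear_combination -h1

theorem log_norm_sq_sub_eq_of_mul_eq {p q r s : ℂ} (hp : p ≠ 0) (hq : q ≠ 0) (hr : r ≠ 0)
    (hs : s ≠ 0) (h : p * q = r * s) :
    Real.log (‖p‖ ^ 2) - Real.log (‖r‖ ^ 2) = Real.log (‖s‖ ^ 2) - Real.log (‖q‖ ^ 2) := by
  have h1 : ‖p‖ ^ 2 * ‖q‖ ^ 2 = ‖r‖ ^ 2 * ‖s‖ ^ 2 := by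
    rw [← mul_pow, ← mul_pow, ← norm_mul, ← norm_mul, h]
  have h2 := congrArg Real.log h1
  have pos : ∀ z : ℂ, z ≠ 0 → ‖z‖ ^ 2 ≠ 0 := fun z hz => pow_ne_zero _ (norm_ne_zero_iff.2 hz)
  rw [Real.log_mul (pos p hp) (pos q hq), Real.log_mul (pos r hr) (pos s hs)] at h2
  linarith

theorem log_norm_sq_sub_eq_of_ker_eq {φ ψ : Module.Dual ℂ V}
    (h : LinearMap.ker φ = LinearMap.ker ψ) {x y : V} (hx : φ x ≠ 0) (hy : φ y ≠ 0) :
    Real.log (‖φ x‖ ^ 2) - Real.log (‖φ y‖ ^ 2) = Real.log (‖ψ x‖ ^ 2) - Real.log (‖ψ y‖ ^ 2) := by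
  have hne : ∀ {z}, φ z ≠ 0 → ψ z ≠ 0 := fun {z} hz h0 => hz <| by
    have : z ∈ LinearMap.ker φ := by rw [h]; exact h0
    exact this
  exact log_norm_sq_sub_eq_of_mul_eq hx (hne hy) hy (hne hx)
    ((mul_apply_eq_of_ker_eq h.symm x y).trans (mul_comm _ _))

end Functionals

/-- The z_i(x) are the coordinates of x in an orthonormal basis. The sum thus depends only on h,
which is why it cancels between the Levine forms of C and D. -/
theorem IsOrthonormalCoframe.sum_sq {h : HermitianMetric (Fin n → ℂ)}
    {z : Fin n → Module.Dual ℂ (Fin n → ℂ)} (hz : IsOrthonormalCoframe h z) (x : Fin n → ℂ) :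
    ((∑ i, ‖z i x‖ ^ 2 : ℝ) : ℂ) = h.inner x x := by
  obtain ⟨v, hv, hzv⟩ := hz
  have hli : LinearIndependent ℂ v := by
    rw [Fintype.linearIndependent_iff]
    intro c hc i
    have := congrArg (z i) hc
    simpa [hzv] using this
  have hcard : Fintype.card (Fin n) = Module.finrank ℂ (Fin n → ℂ) := by simp
  let b := basisOfLinearIndependentOfCardEqFinrank' v hli hcard
  have hb : ∀ i, b i = v i := fun i => by simp [b]
  have hx : x = ∑ i, z i x • v i := by
    have h1 := b.sum_repr x
    simp only [hb] at h1
    have h2 : ∀ i, z i x = b.repr x i := fun i => by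
      conv_lhs => rw [← h1]
      simp [hzv]
    simp only [h2, h1]
  conv_rhs => rw [hx]
  exact (metric_self_eq_sum h hv _).symm

theorem exists_ker_eq_of_finrank_add_one {C : Submodule ℂ (Fin n → ℂ)}
    (hC : Module.finrank ℂ C + 1 = n) :
    ∃ w : Fin n → ℂ, w ≠ 0 ∧ ∀ x, x ∈ C ↔ star w ⬝ᵥ x = 0 := by
  have hlt : C < ⊤ := by
    refine lt_top_iff_ne_top.2 fun h => ?_
    rw [h, finrank_top] at hC
    simp at hC
  obtain ⟨f, hf, hle⟩ := C.exists_le_ker_of_lt_top hlt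
  have hker : C = LinearMap.ker f := by
    apply Submodule.eq_of_le_of_finrank_eq hle
    have h1 := f.finrank_range_add_finrank_ker
    have h2 : Module.finrank ℂ (LinearMap.range f) = 1 := by
      rw [LinearMap.range_eq_top.2 (LinearMap.surjective hf)]
      simp
    rw [h2, Module.finrank_fin_fun] at h1
    omega
  let w : Fin n → ℂ := fun i => star (f (Pi.single i 1))
  have hw : ∀ x, star w ⬝ᵥ x = f x := fun x => by
    conv_rhs => rw [pi_eq_sum_univ' x]
    simp [dotProduct, w, mul_comm]
  refine ⟨w, ?_, fun x => ?_⟩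
  · intro h0
    apply hf
    ext i
    rw [LinearMap.comp_apply, LinearMap.single_apply, ← hw, h0]
    simp
  · rw [hw, hker, LinearMap.mem_ker]

/-- The standard hermitian metric on `ℂⁿ`. -/
@[reducible]
def stdMetric (n : ℕ) : HermitianMetric (Fin n → ℂ) where
  inner x y := star x ⬝ᵥ y
  conj_inner_symm x y := by
    change star _ = _
    rw [Matrix.star_dotProduct, star_star]
  re_inner_nonneg x := by
    rw [← nsq_eq_dotProduct]
    exact nsq_nonneg x
  add_left x y z := by rw [star_add, add_dotProduct]
  smul_left x y r := by rw [star_smul, smul_dotProduct]; rfl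
  definite x hx := by
    rw [← nsq_eq_dotProduct] at hx
    exact nsq_eq_zero.1 (by exact_mod_cast hx)

/-- A unitary V taking a basis vector to the normal direction w of C gives the coframe x ↦ Vᴴx. The
difference of logarithms is invariant under scaling, so it may be evaluated on chosen
representatives. -/
theorem exists_isLevineForm_stdMetric {C : Submodule ℂ (Fin n → ℂ)}
    (hC : Module.finrank ℂ C + 1 = n) : ∃ Λ, IsLevineForm (stdMetric n) C Λ := by
  obtain ⟨w, hw0, hw⟩ := exists_ker_eq_of_finrank_add_one hC
  let i₀ : Fin n := ⟨0, by omega⟩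
  obtain ⟨V, hV, c, hc, hVw⟩ := exists_unitary_conjTranspose_mulVec_eq_single i₀ hw0
  have hV' : Vᴴ * V = 1 := mul_eq_one_comm.1 hV
  let z : Fin n → Module.Dual ℂ (Fin n → ℂ) := fun i => LinearMap.proj i ∘ₗ Matrix.toLin' Vᴴ
  have hz : ∀ i x, z i x = (Vᴴ *ᵥ x) i := fun i x => rfl
  have hker : ∀ x, x ∈ C ↔ z i₀ x = 0 := by
    intro x
    have h1 : star w ⬝ᵥ x = star c * z i₀ x := by
      have hw2 : w = V *ᵥ Pi.single i₀ c := by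
        rw [← hVw, Matrix.mulVec_mulVec, hV, Matrix.one_mulVec]
      rw [hz, hw2, Matrix.star_mulVec, ← Matrix.dotProduct_mulVec, Pi.star_single,
        single_dotProduct]
    rw [hw, h1, mul_eq_zero, star_eq_zero, or_iff_right hc]
  refine ⟨fun p => Real.log (∑ i, ‖z i p.rep‖ ^ 2) - Real.log (‖z i₀ p.rep‖ ^ 2), z, i₀,
    ⟨fun j => V *ᵥ Pi.single j 1, fun i j => ?_, fun i j => ?_⟩, ?_, fun x hx hxC => ?_⟩
  · change star (V *ᵥ Pi.single i 1) ⬝ᵥ (V *ᵥ Pi.single j 1) = _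
    rw [Matrix.star_mulVec, ← Matrix.dotProduct_mulVec, Matrix.mulVec_mulVec, hV',
      Matrix.one_mulVec, Pi.star_single, single_dotProduct, star_one, one_mul, Pi.single_apply]
  · rw [hz, Matrix.mulVec_mulVec, hV', Matrix.one_mulVec, Pi.single_apply]
  · ext x
    rw [LinearMap.mem_ker, hker]
  · obtain ⟨a, ha⟩ := Projectivization.exists_smul_eq_mk_rep ℂ x hx
    have hx0 : z i₀ x ≠ 0 := mt (hker x).2 hxC
    have hpos : 0 < ‖z i₀ x‖ ^ 2 := pow_pos (norm_pos_iff.2 hx0) 2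
    have hsum : 0 < ∑ i, ‖z i x‖ ^ 2 :=
      Finset.sum_pos' (fun _ _ => sq_nonneg _) ⟨i₀, Finset.mem_univ _, hpos⟩
    have ha0 : 0 < ‖(a : ℂ)‖ ^ 2 := pow_pos (norm_pos_iff.2 a.ne_zero) 2
    have hrep : ∀ i, ‖z i (Projectivization.mk ℂ x hx).rep‖ ^ 2 = ‖(a : ℂ)‖ ^ 2 * ‖z i x‖ ^ 2 := by
      intro i
      rw [← ha, Units.smul_def, map_smul, norm_smul, mul_pow]
    simp only [hrep]
    rw [← Finset.mul_sum, Real.log_mul ha0.ne' hsum.ne', Real.log_mul ha0.ne' hpos.ne']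
    ring

/-- The sums of squares cancel, and each distinguished coframe element may be replaced by any
equation of its hyperplane because only ratios of values at a and b enter. The converse needs Levine
forms to exist for one metric; the standard one serves. -/
theorem isIntersectionNumber_iff {C D : Submodule ℂ (Fin n → ℂ)}
    (hC : Module.finrank ℂ C + 1 = n) (hD : Module.finrank ℂ D + 1 = n)
    {φ ψ : Module.Dual ℂ (Fin n → ℂ)} (hφ : LinearMap.ker φ = C) (hψ : LinearMap.ker ψ = D)
    {a b : Fin n → ℂ} (ha : a ≠ 0) (hb : b ≠ 0) (haC : φ a ≠ 0) (haD : ψ a ≠ 0) (hbC : φ b ≠ 0)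
    (hbD : ψ b ≠ 0) (m : ℝ) :
    IsIntersectionNumber (Projectivization.mk ℂ a ha) (Projectivization.mk ℂ b hb) C D m ↔
      m = (Real.log (‖ψ a‖ ^ 2) - Real.log (‖ψ b‖ ^ 2))
        - (Real.log (‖φ a‖ ^ 2) - Real.log (‖φ b‖ ^ 2)) := by
  have hval : ∀ (h : HermitianMetric (Fin n → ℂ)) (ΛC ΛD : ℙ ℂ (Fin n → ℂ) → ℝ),
      IsLevineForm h C ΛC → IsLevineForm h D ΛD →
      (ΛC (Projectivization.mk ℂ a ha) - ΛD (Projectivization.mk ℂ a ha))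
        - (ΛC (Projectivization.mk ℂ b hb) - ΛD (Projectivization.mk ℂ b hb))
      = (Real.log (‖ψ a‖ ^ 2) - Real.log (‖ψ b‖ ^ 2))
        - (Real.log (‖φ a‖ ^ 2) - Real.log (‖φ b‖ ^ 2)) := by
    rintro h ΛC ΛD ⟨z, i, hz, hzi, hΛC⟩ ⟨z', j, hz', hzj, hΛD⟩
    have hs : ∀ x, ∑ i, ‖z i x‖ ^ 2 = ∑ i, ‖z' i x‖ ^ 2 := fun x => by
      have := (hz.sum_sq x).trans (hz'.sum_sq x).symm
      exact_mod_cast this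
    have hmC : ∀ {x}, φ x ≠ 0 → x ∉ C := fun {x} hx hmem => hx (by rwa [← hφ] at hmem)
    have hmD : ∀ {x}, ψ x ≠ 0 → x ∉ D := fun {x} hx hmem => hx (by rwa [← hψ] at hmem)
    rw [hΛC a ha (hmC haC), hΛC b hb (hmC hbC), hΛD a ha (hmD haD), hΛD b hb (hmD hbD), hs, hs,
      log_norm_sq_sub_eq_of_ker_eq (hφ.trans hzi.symm) haC hbC,
      log_norm_sq_sub_eq_of_ker_eq (hψ.trans hzj.symm) haD hbD]
    ring
  constructor
  · rintro ⟨h, ΛC, ΛD, h1, h2, rfl⟩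
    exact hval h ΛC ΛD h1 h2
  · rintro rfl
    obtain ⟨ΛC, h1⟩ := exists_isLevineForm_stdMetric hC
    obtain ⟨ΛD, h2⟩ := exists_isLevineForm_stdMetric hD
    exact ⟨stdMetric n, ΛC, ΛD, h1, h2, (hval _ ΛC ΛD h1 h2).symm⟩

/-! ### Geodesics attached to hermitian metrics -/

theorem mulVec_eq_sum_smul_single (M : Mat n) (u : Fin n → ℂ) :
    M *ᵥ u = ∑ i, u i • (M *ᵥ Pi.single i 1) := by
  conv_lhs => rw [pi_eq_sum_univ' u]
  rw [Matrix.mulVec_sum]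
  exact Finset.sum_congr rfl fun i _ => by rw [Matrix.mulVec_smul]

theorem MapsToOrthonormalBasis.mem_iff {g : G n} {P : Fin n → Prop}
    {W : Submodule ℂ (Fin n → ℂ)} {h : HermitianMetric W} (H : MapsToOrthonormalBasis g P h)
    (v : Fin n → ℂ) : v ∈ W ↔ ∀ i, ¬ P i → (((g⁻¹ : G n) : Mat n) *ᵥ v) i = 0 := by
  classical
  obtain ⟨-, w, -, hw, -⟩ := H
  constructor
  · intro hv i hi
    have h1 := congrArg Subtype.val (w.sum_repr ⟨v, hv⟩)
    rw [AddSubmonoidClass.coe_finsetSum] at h1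
    simp only [SetLike.val_smul, hw] at h1
    rw [← h1, Matrix.mulVec_sum, Finset.sum_apply]
    refine Finset.sum_eq_zero fun j _ => ?_
    rw [Matrix.mulVec_smul, inv_mulVec_coe_mulVec, Pi.smul_apply, Pi.single_eq_of_ne, smul_zero]
    rintro rfl
    exact hi j.2
  · intro hv
    rw [← coe_mulVec_inv_mulVec g v, mulVec_eq_sum_smul_single]
    refine W.sum_mem fun i _ => ?_
    by_cases hi : P i
    · rw [← hw ⟨i, hi⟩]
      exact W.smul_mem _ (w ⟨i, hi⟩).2
    · rw [hv i hi, zero_smul]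
      exact W.zero_mem

/-- The freedom of a positive multiple of h absorbs the scalar ζ that is needed to reach determinant
1. -/
theorem mapsToOrthonormalBasis_of_smul {g : G n} {P : Fin n → Prop}
    {W : Submodule ℂ (Fin n → ℂ)} {h : HermitianMetric W}
    (w : Module.Basis {i : Fin n // P i} ℂ W)
    (hw : ∀ i j, h.inner (w i) (w j) = if i = j then 1 else 0) {ζ : ℂ} (hζ : ζ ≠ 0)
    (hg : ∀ i : {i : Fin n // P i}, (g : Mat n) *ᵥ Pi.single (i : Fin n) 1 = ζ • (w i : Fin n → ℂ)) :
    MapsToOrthonormalBasis g P h := by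
  refine ⟨(‖ζ‖ ^ 2)⁻¹, w.unitsSMul fun _ => Units.mk0 ζ hζ, ?_, fun i => ?_, fun i j => ?_⟩
  · have := norm_pos_iff.2 hζ
    positivity
  · rw [Module.Basis.unitsSMul_apply, hg]
    rfl
  · rw [Module.Basis.unitsSMul_apply, Module.Basis.unitsSMul_apply, Units.smul_def, Units.smul_def,
      Units.val_mk0, h.smul_left, metric_smul_right, hw, ← mul_assoc, ← mul_assoc, mul_assoc _ _ ζ,
      Complex.conj_mul']
    have : (‖ζ‖ : ℂ) ^ 2 ≠ 0 := pow_ne_zero _ (by exact_mod_cast norm_ne_zero_iff.2 hζ)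
    push_cast
    rw [inv_mul_cancel₀ this, one_mul]

theorem exists_mapsToOrthonormalBasis {W W' : Submodule ℂ (Fin n → ℂ)} (hWW' : IsCompl W W')
    {r : ℕ} (hr : Module.finrank ℂ W = r) (hn : 0 < n)
    (h : HermitianMetric W) (h' : HermitianMetric W') :
    ∃ g : G n, MapsToOrthonormalBasis g (fun i => (i : ℕ) < r) h ∧
      MapsToOrthonormalBasis g (fun i => ¬ (i : ℕ) < r) h' := by
  have hadd := Submodule.finrank_add_eq_of_isCompl hWW'
  rw [Module.finrank_fin_fun, hr] at hadd
  have hc1 : Fintype.card {i : Fin n // (i : ℕ) < r} = r := by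
    have e : {i : Fin n // (i : ℕ) < r} ≃ Fin r :=
      ⟨fun i => ⟨i.1, i.2⟩, fun j => ⟨⟨j, by omega⟩, j.2⟩, fun _ => rfl, fun _ => rfl⟩
    rw [Fintype.card_congr e, Fintype.card_fin]
  have hc2 : Fintype.card {i : Fin n // ¬ (i : ℕ) < r} = n - r := by
    rw [Fintype.card_subtype_compl, hc1, Fintype.card_fin]
  obtain ⟨w, hw⟩ := exists_orthonormal_basis_metric h (hr.trans hc1.symm)
  obtain ⟨w', hw'⟩ := exists_orthonormal_basis_metric h'
    (show Module.finrank ℂ W' = Fintype.card {i : Fin n // ¬ (i : ℕ) < r} by omega)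
  let b : Module.Basis (Fin n) ℂ (Fin n → ℂ) :=
    ((w.prod w').map (W.prodEquivOfIsCompl W' hWW')).reindex
      (Equiv.sumCompl fun i : Fin n => (i : ℕ) < r)
  have hb1 : ∀ i : {i : Fin n // (i : ℕ) < r}, b i = w i := fun i => by
    simp [b]
  have hb2 : ∀ i : {i : Fin n // ¬ (i : ℕ) < r}, b i = w' i := fun i => by
    simp [b]
  let M : Mat n := Matrix.of fun i j => b j i
  have hM : ∀ j, M *ᵥ Pi.single j 1 = b j := fun j => by
    rw [Matrix.mulVec_single_one]
    rfl
  have hdet : M.det ≠ 0 := (Module.Basis.isUnit_det (Pi.basisFun ℂ (Fin n)) b).ne_zero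
  obtain ⟨ζ, hζ⟩ := IsAlgClosed.exists_pow_nat_eq (M.det)⁻¹ hn
  have hζ0 : ζ ≠ 0 := by
    rintro rfl
    rw [zero_pow hn.ne'] at hζ
    exact inv_ne_zero hdet hζ.symm
  let g : G n := ⟨ζ • M, by
    rw [Matrix.det_smul, Fintype.card_fin, hζ, inv_mul_cancel₀ hdet]⟩
  have hg : ∀ j, (g : Mat n) *ᵥ Pi.single j 1 = ζ • b j := fun j => by
    change (ζ • M) *ᵥ _ = _
    rw [Matrix.smul_mulVec, hM]
  exact ⟨g, mapsToOrthonormalBasis_of_smul w hw hζ0 fun i => by rw [hg, hb1],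
    mapsToOrthonormalBasis_of_smul w' hw' hζ0 fun i => by rw [hg, hb2]⟩

section Hyperplane

variable {C W' : Submodule ℂ (Fin n → ℂ)}

theorem unitEntry_eq_sqrt {r : ℕ} (hr : r + 1 = n) :
    √(((n : ℝ) - r) / (4 * r * (n : ℝ) ^ 2)) = unitEntry n := by
  have hrn : (n : ℝ) - 1 = r := by rw [← hr]; push_cast; ring
  have h1 : (n : ℝ) - r = 1 := by linarith
  have hnn : (0 : ℝ) ≤ n := Nat.cast_nonneg n
  rw [unitEntry, h1, hrn, Real.sqrt_div zero_le_one, Real.sqrt_one,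
    show (4 : ℝ) * r * (n : ℝ) ^ 2 = (2 * n) ^ 2 * r by ring, Real.sqrt_mul (sq_nonneg _),
    Real.sqrt_sq (by positivity)]

theorem neg_smul_pDiag_eq {x : Fin n → ℝ} {hx : ∑ i, x i = 0} {X : pSpace n}
    (hX : (X : Mat n) = realDiag fun i => -x i) (t : ℝ) : t • X = (-t) • pDiag x hx := by
  apply Subtype.ext
  change t • (X : Mat n) = (-t) • realDiag x
  rw [hX]
  ext i j
  by_cases hij : i = j
  · subst hij
    simp [realDiag]
  · simp [realDiag, hij]

/-- For r = n - 1 one gets σ = -(n - 1)ρ, so the standard direction is minus a spike at the last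
index. Standard parametrizations therefore run towards C, against the orientation from C to W'. -/
theorem standard_diagonal_eq {r : ℕ} (hr : r + 1 = n) (i₀ : Fin n)
    (hi₀ : ∀ i : Fin n, ¬ (i : ℕ) < r ↔ i = i₀) {ρ σ : ℝ} (hρ : ρ = unitEntry n)
    (hσ : σ = -(r / ((n : ℝ) - r)) * ρ) :
    Matrix.diagonal (fun i : Fin n => if (i : ℕ) < r then (ρ : ℂ) else (σ : ℂ))
      = realDiag fun i => -spike i₀ (unitEntry n) i := by
  have hrn : (n : ℝ) - 1 = r := by rw [← hr]; push_cast; ring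
  have h1 : (n : ℝ) - r = 1 := by linarith
  rw [realDiag]
  congr 1
  ext i
  by_cases hi : (i : ℕ) < r
  · have : i ≠ i₀ := fun h => (hi₀ i).2 h hi
    rw [if_pos hi, spike_of_ne this, neg_neg, hρ]
  · rw [if_neg hi, (hi₀ i).1 hi, spike_self, hσ, h1, hρ, hrn]
    push_cast
    ring

theorem exists_last_index {r : ℕ} (hr : r + 1 = n) :
    ∃ i₀ : Fin n, ∀ i : Fin n, ¬ (i : ℕ) < r ↔ i = i₀ :=
  ⟨⟨r, by omega⟩, fun i => by rw [Fin.ext_iff]; simp only; omega⟩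

theorem inv_mul_expG_mulVec (g : G n) (x : Fin n → ℝ) (hx : ∑ i, x i = 0) (s : ℝ)
    (v : Fin n → ℂ) :
    (((g * expG (s • pDiag x hx))⁻¹ : G n) : Mat n) *ᵥ v = fun i =>
      (Real.exp (-s * x i) : ℂ) * (((g⁻¹ : G n) : Mat n) *ᵥ v) i := by
  ext i
  rw [mul_inv_rev, inv_expG_pDiag, Matrix.SpecialLinearGroup.coe_mul, ← Matrix.mulVec_mulVec,
    coe_expG_pDiag, realDiag_mulVec]

/-- The geodesics attached to hermitian metrics on a hyperplane and on a complementary line, in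
diagonal form. -/
theorem IsOrientedGeodesic.exists_spike (hn : 2 ≤ n) (hC : Module.finrank ℂ C + 1 = n)
    {h : HermitianMetric C} {h' : HermitianMetric W'} {γ : ℝ → Z n}
    (H : IsOrientedGeodesic h h' γ) :
    ∃ (g : G n) (i₀ : Fin n),
      (∀ t, γ t = geod g (pDiag (spike i₀ (unitEntry n)) (sum_spike _ _)) t) ∧
      (∀ v, v ∈ C ↔ (((g⁻¹ : G n) : Mat n) *ᵥ v) i₀ = 0) ∧
      ∀ v, v ∈ W' ↔ ∀ i, i ≠ i₀ → (((g⁻¹ : G n) : Mat n) *ᵥ v) i = 0 := by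
  obtain ⟨⟨γ₀, ⟨g, X, r, ρ, σ, hr, hρ, hσ, hg, hg', hX, hγ₀⟩, c, hγ⟩, -, δ, hδ, hδW'⟩ := H
  rw [← hr] at hC
  obtain ⟨i₀, hi₀⟩ := exists_last_index hC
  have hX' := hX.trans (standard_diagonal_eq hC i₀ hi₀ (hρ.trans (unitEntry_eq_sqrt hC)) hσ)
  set u := unitEntry n with hu
  have hu0 : 0 < u := unitEntry_pos hn
  set D := pDiag (spike i₀ u) (sum_spike _ _) with hD
  have hγD : ∀ t, γ₀ t = geod g D (-t) := fun t => by
    rw [hγ₀, geod, neg_smul_pDiag_eq hX', geod]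
  -- Moving the base point along the geodesic rescales coordinates by positive factors and leaves
  -- their vanishing unchanged.
  have hEz : ∀ (s : ℝ) v i, ((((g * expG (s • D))⁻¹ : G n) : Mat n) *ᵥ v) i = 0 ↔
      (((g⁻¹ : G n) : Mat n) *ᵥ v) i = 0 := fun s v i => by
    rw [hD, inv_mul_expG_mulVec, mul_eq_zero, or_iff_right]
    exact_mod_cast (Real.exp_pos _).ne'
  have hmC : ∀ v, v ∈ C ↔ (((g⁻¹ : G n) : Mat n) *ᵥ v) i₀ = 0 := fun v => by
    rw [hg.mem_iff]
    simp only [hi₀, forall_eq]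
  have hmW' : ∀ v, v ∈ W' ↔ ∀ i, i ≠ i₀ → (((g⁻¹ : G n) : Mat n) *ᵥ v) i = 0 := fun v => by
    rw [hg'.mem_iff]
    simp only [hi₀, ne_eq]
  rcases hγ with hγ | hγ
  -- With the orientation of γ₀ the direction has its strict minimum at i₀, whereas ending at the
  -- boundary point of the line W' demands a strict maximum there.
  · exfalso
    have hx : ∑ i, -spike i₀ u i = 0 := by rw [Finset.sum_neg_distrib, sum_spike, neg_zero]
    have hδ' : ∀ t : ℝ≥0, δ.toFun t = geod (g * expG ((-c) • D))
        (pDiag (fun i => -spike i₀ u i) hx) t := fun t => by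
      rw [hδ, hγ, hγD, neg_add, hD, geod_pDiag_add, ← hD, geod, geod,
        neg_smul_pDiag_eq (hx := sum_spike i₀ u) (X := pDiag (fun i => -spike i₀ u i) hx) rfl]
    set a := (g : Mat n) *ᵥ Pi.single i₀ 1 with ha
    have hga : ((g⁻¹ : G n) : Mat n) *ᵥ a = Pi.single i₀ 1 := inv_mulVec_coe_mulVec g _
    have hspan : W' = Submodule.span ℂ {a} := by
      ext v
      rw [hmW', mem_span_singleton_iff_of_inv_mulVec one_ne_zero hga]
    have ha0 : a ≠ 0 := fun h0 => by
      rw [h0, Matrix.mulVec_zero] at hga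
      simpa using congrFun hga i₀
    rw [hspan] at hδW'
    obtain ⟨i₁, hi₁, μ, hμ, hμ'⟩ := direction_of_isBoundaryPointOf_span hn hδ' ha0 hδW'
    have h01 : i₀ = i₁ := by
      by_contra hne
      have h1 := (hEz _ a i₀).1 (hi₁ i₀ hne)
      rw [hga, Pi.single_eq_same] at h1
      exact one_ne_zero h1
    subst h01
    have : Nontrivial (Fin n) := Fin.nontrivial_iff_two_le.2 hn
    obtain ⟨j, hj⟩ := exists_ne i₀
    rw [← hμ' j hj, neg_lt_neg_iff, spike_lt_spike_iff hn hu0] at hμ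
    exact hμ.1 rfl
  · refine ⟨g * expG ((-c) • D), i₀, fun t => ?_, fun v => ?_, fun v => ?_⟩
    · rw [hγ, hγD, neg_sub, sub_eq_neg_add, hD, geod_pDiag_add]
    · rw [hmC, hEz]
    · simp only [hmW', hEz]

theorem exists_isOrientedGeodesic (hn : 2 ≤ n) (hC : Module.finrank ℂ C + 1 = n)
    (hCW' : IsCompl C W') (h : HermitianMetric C) (h' : HermitianMetric W') :
    ∃ γ, IsOrientedGeodesic h h' γ := by
  obtain ⟨g, hg, hg'⟩ := exists_mapsToOrthonormalBasis hCW' rfl (by omega) h h'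
  set r := Module.finrank ℂ C with hr
  obtain ⟨i₀, hi₀⟩ := exists_last_index hC
  have hu0 : 0 < unitEntry n := unitEntry_pos hn
  set D := pDiag (spike i₀ (unitEntry n)) (sum_spike _ _) with hD
  have hx : ∑ i, -spike i₀ (unitEntry n) i = 0 := by
    rw [Finset.sum_neg_distrib, sum_spike, neg_zero]
  set X := pDiag (fun i => -spike i₀ (unitEntry n) i) hx with hX
  have hXD : ∀ t, geod g X (0 - t) = geod g D t := fun t => by
    rw [geod, neg_smul_pDiag_eq (hx := sum_spike i₀ (unitEntry n)) (X := X) rfl, geod, zero_sub,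
      neg_neg]
  refine ⟨fun t => geod g X (0 - t), ⟨fun t => geod g X t, ⟨g, X, r, _, _, hr, rfl, rfl, hg, hg',
    ?_, fun _ => rfl⟩, 0, Or.inr fun _ => rfl⟩, ?_, ?_⟩
  · exact (standard_diagonal_eq hC i₀ hi₀ (unitEntry_eq_sqrt hC) rfl).symm
  · let δ : Ray n := ⟨fun t => geod g X t, g, X, by
      rw [hX, coe_pDiag, killing_realDiag]
      simp only [neg_sq]
      rw [← killing_realDiag, killing_spike_unitEntry hn], fun _ => rfl⟩
    refine ⟨δ, fun t => by simp [δ], isBoundaryPointOf_of_two_valued hn (δ := δ) (fun _ => rfl)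
      (P := fun i => (i : ℕ) < r) (fun i j => ?_) hg.mem_iff⟩
    rw [neg_lt_neg_iff, spike_lt_spike_iff hn hu0, ← hi₀, ← hi₀, not_not, and_comm]
  · let δ : Ray n := ⟨fun t => geod g D t, g, D, killing_spike_unitEntry hn i₀, fun _ => rfl⟩
    refine ⟨δ, fun t => (hXD t).symm, isBoundaryPointOf_of_two_valued hn (δ := δ) (fun _ => rfl)
      (P := fun i => ¬ (i : ℕ) < r) (fun i j => ?_) hg'.mem_iff⟩
    rw [spike_lt_spike_iff hn hu0, ← hi₀, ← hi₀]

end Hyperplane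

/-! ### The plane ⟨A,B⟩ and the final computation -/

section Plane

variable {V : Type*} [AddCommGroup V] [Module ℂ V]

theorem isCompl_ker_span_singleton {φ : Module.Dual ℂ V} {l : V} (hl : φ l ≠ 0) :
    IsCompl (LinearMap.ker φ) (Submodule.span ℂ {l}) := by
  constructor
  · rw [Submodule.disjoint_def]
    intro x hx hxl
    obtain ⟨c, rfl⟩ := Submodule.mem_span_singleton.1 hxl
    rw [LinearMap.mem_ker, map_smul, smul_eq_mul] at hx
    rw [(mul_eq_zero.1 hx).resolve_right hl, zero_smul]
  · rw [codisjoint_iff, eq_top_iff]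
    intro x _
    refine Submodule.mem_sup.2 ⟨x - (φ x / φ l) • l, ?_, (φ x / φ l) • l,
      Submodule.smul_mem _ _ (Submodule.mem_span_singleton_self l), sub_add_cancel _ _⟩
    rw [LinearMap.mem_ker, map_sub, map_smul, smul_eq_mul, div_mul_cancel₀ _ hl, sub_self]

/-- The intersection of the plane spanned by two vectors with a hyperplane. -/
theorem span_sup_span_inf_ker {φ : Module.Dual ℂ V} {a b : V} (hb : φ b ≠ 0) :
    (Submodule.span ℂ {a} ⊔ Submodule.span ℂ {b}) ⊓ LinearMap.ker φ
      = Submodule.span ℂ {φ b • a - φ a • b} := by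
  apply le_antisymm
  · rintro x ⟨hx, hφ⟩
    obtain ⟨y, hy, z, hz, rfl⟩ := Submodule.mem_sup.1 hx
    obtain ⟨s, rfl⟩ := Submodule.mem_span_singleton.1 hy
    obtain ⟨t, rfl⟩ := Submodule.mem_span_singleton.1 hz
    rw [SetLike.mem_coe, LinearMap.mem_ker, map_add, map_smul, map_smul, smul_eq_mul,
      smul_eq_mul] at hφ
    -- The relation sφ(a) + tφ(b) = 0 gives t = -(s/φ(b))φ(a).
    refine Submodule.mem_span_singleton.2 ⟨s / φ b, ?_⟩
    rw [smul_sub, smul_smul, smul_smul, div_mul_cancel₀ _ hb, sub_eq_add_neg, ← neg_smul]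
    congr 2
    field_simp
    linear_combination -hφ
  · rw [Submodule.span_singleton_le_iff_mem]
    refine ⟨Submodule.sub_mem _
      (Submodule.smul_mem _ _ (Submodule.mem_sup_left (Submodule.mem_span_singleton_self a)))
      (Submodule.smul_mem _ _ (Submodule.mem_sup_right (Submodule.mem_span_singleton_self b))), ?_⟩
    rw [SetLike.mem_coe, LinearMap.mem_ker, map_sub, map_smul, map_smul, smul_eq_mul, smul_eq_mul]
    ring

end Plane

/-- Here v, w are the coordinates of a, b and p, q the values ψ(a), ψ(b). The terms log(n - 1)
cancel, and proportionality off i₀ turns the ratio of the remaining sums into |p/q|². -/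
theorem gateTime_sub_gateTime (hn : 2 ≤ n) {i₀ : Fin n} {v w : Fin n → ℂ} {p q : ℂ}
    (hv : v i₀ ≠ 0) (hw : w i₀ ≠ 0) (hv' : ∃ i, i ≠ i₀ ∧ v i ≠ 0) (hw' : ∃ i, i ≠ i₀ ∧ w i ≠ 0)
    (hp : p ≠ 0) (hq : q ≠ 0) (hvw : ∀ i, i ≠ i₀ → q * v i = p * w i) :
    1 / √((n : ℝ) - 1) * (gateTime i₀ w - gateTime i₀ v)
      = (Real.log (‖p‖ ^ 2) - Real.log (‖q‖ ^ 2))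
        - (Real.log (‖v i₀‖ ^ 2) - Real.log (‖w i₀‖ ^ 2)) := by
  have hn' : (2 : ℝ) ≤ n := by exact_mod_cast hn
  have hsq := sqrt_sub_one_pos hn
  have pos : ∀ z : ℂ, z ≠ 0 → ‖z‖ ^ 2 ≠ 0 := fun z hz => pow_ne_zero _ (norm_ne_zero_iff.2 hz)
  have hS : ∀ u : Fin n → ℂ, (∃ i, i ≠ i₀ ∧ u i ≠ 0) →
      ∑ i ∈ Finset.univ.erase i₀, ‖u i‖ ^ 2 ≠ 0 := by
    rintro u ⟨i, hi, hui⟩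
    exact (Finset.sum_pos' (f := fun j => ‖u j‖ ^ 2) (fun _ _ => sq_nonneg _)
      ⟨i, Finset.mem_erase.2 ⟨hi, Finset.mem_univ _⟩, pow_pos (norm_pos_iff.2 hui) 2⟩).ne'
  have hsum : ‖q‖ ^ 2 * ∑ i ∈ Finset.univ.erase i₀, ‖v i‖ ^ 2
      = ‖p‖ ^ 2 * ∑ i ∈ Finset.univ.erase i₀, ‖w i‖ ^ 2 := by
    rw [Finset.mul_sum, Finset.mul_sum]
    refine Finset.sum_congr rfl fun i hi => ?_
    rw [← mul_pow, ← mul_pow, ← norm_mul, ← norm_mul, hvw i (Finset.ne_of_mem_erase hi)]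
  have hlog := congrArg Real.log hsum
  rw [Real.log_mul (pos q hq) (hS v hv'), Real.log_mul (pos p hp) (hS w hw')] at hlog
  have hm : (n : ℝ) - 1 ≠ 0 := by linarith
  have hval : ∀ u : Fin n → ℂ, u i₀ ≠ 0 → (∃ i, i ≠ i₀ ∧ u i ≠ 0) →
      gateTime i₀ u = √((n : ℝ) - 1) * (Real.log ((n : ℝ) - 1) + (Real.log (‖u i₀‖ ^ 2)
        - Real.log (∑ i ∈ Finset.univ.erase i₀, ‖u i‖ ^ 2))) := by
    intro u hu hu'
    rw [gateTime, Real.log_mul hm (div_ne_zero (pos _ hu) (hS u hu')),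
      Real.log_div (pos _ hu) (hS u hu')]
  rw [hval v hv hv', hval w hw hw', ← mul_sub, ← mul_assoc, one_div_mul_cancel hsq.ne', one_mul]
  linarith

end ArchInt

theorem corollary5p2 {n : ℕ} (a b : ℙ ℂ (Fin n → ℂ)) (hab : a ≠ b)
    (C D : Submodule ℂ (Fin n → ℂ))
    (hC : Module.finrank ℂ C + 1 = n) (hD : Module.finrank ℂ D + 1 = n) (hCD : C ≠ D)
    (hdisj : Disjoint {a, b} (ArchInt.projPoints C ∪ ArchInt.projPoints D)) :
    ∃ m : ℝ, (∀ m', ArchInt.IsIntersectionNumber a b C D m' ↔ m' = m) ∧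
      ((a.submodule ⊔ b.submodule) ⊓ C = (a.submodule ⊔ b.submodule) ⊓ D → m = 0) ∧
      ((a.submodule ⊔ b.submodule) ⊓ C ≠ (a.submodule ⊔ b.submodule) ⊓ D →
        ∀ (h₀ : ArchInt.HermitianMetric ↥(C ⊓ D))
          (h₁ : ArchInt.HermitianMetric ↥((a.submodule ⊔ b.submodule) ⊓ C))
          (h₂ : ArchInt.HermitianMetric ↥((a.submodule ⊔ b.submodule) ⊓ D)),
        ∃ h : ArchInt.HermitianMetric C,
          (∀ h', ArchInt.IsOrthogonalSum h₀ h₁ h' ↔ h' = h) ∧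
          (∃ γ, ArchInt.IsOrientedGeodesic h h₂ γ) ∧
          ∀ γ, ArchInt.IsOrientedGeodesic h h₂ γ →
            (∃! x, ArchInt.IsGate γ a.submodule x) ∧ (∃! y, ArchInt.IsGate γ b.submodule y) ∧
            ∀ x y, ArchInt.IsGate γ a.submodule x → ArchInt.IsGate γ b.submodule y →
              m = 1 / √((n : ℝ) - 1) * ArchInt.distor γ x y) := by
  -- For n ≤ 1 both hyperplanes would be zero, hence equal.
  have hn : 2 ≤ n := by
    by_contra hlt
    have hC0 : Module.finrank ℂ C = 0 := by omega
    have hD0 : Module.finrank ℂ D = 0 := by omega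
    exact hCD ((Submodule.finrank_eq_zero.1 hC0).trans (Submodule.finrank_eq_zero.1 hD0).symm)
  induction a using Projectivization.ind with | h va hva => ?_
  induction b using Projectivization.ind with | h vb hvb => ?_
  simp only [Projectivization.submodule_mk]
  have hker : ∀ {E : Submodule ℂ (Fin n → ℂ)}, Module.finrank ℂ E + 1 = n →
      ∃ φ : Module.Dual ℂ (Fin n → ℂ), LinearMap.ker φ = E := fun {E} hE => by
    obtain ⟨w, -, hw⟩ := ArchInt.exists_ker_eq_of_finrank_add_one hE
    refine ⟨dotProductBilin ℂ ℂ (star w), ?_⟩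
    ext x
    exact (hw x).symm
  have hout : ∀ {v : Fin n → ℂ} (hv : v ≠ 0),
      Projectivization.mk ℂ v hv ∈ ({Projectivization.mk ℂ va hva, Projectivization.mk ℂ vb hvb} :
        Set (ℙ ℂ (Fin n → ℂ))) → v ∉ C ∧ v ∉ D := fun {v} hv hmem => by
    have h1 := Set.disjoint_left.1 hdisj hmem
    simpa [ArchInt.projPoints] using h1
  obtain ⟨haC, haD⟩ := hout hva (by simp)
  obtain ⟨hbC, hbD⟩ := hout hvb (by simp)
  obtain ⟨φ, rfl⟩ := hker hC
  obtain ⟨ψ, rfl⟩ := hker hD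
  rw [LinearMap.mem_ker] at haC haD hbC hbD
  refine ⟨_, ArchInt.isIntersectionNumber_iff hC hD rfl rfl hva hvb haC haD hbC hbD, ?_, ?_⟩
  · intro heq
    rw [ArchInt.span_sup_span_inf_ker hbC] at heq
    have h1 : φ vb • va - φ va • vb ∈ LinearMap.ker ψ :=
      (heq ▸ Submodule.mem_span_singleton_self _ :
        _ ∈ (Submodule.span ℂ {va} ⊔ Submodule.span ℂ {vb}) ⊓ LinearMap.ker ψ).2
    rw [LinearMap.mem_ker, map_sub, map_smul, map_smul, smul_eq_mul, smul_eq_mul,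
      sub_eq_zero] at h1
    rw [ArchInt.log_norm_sq_sub_eq_of_mul_eq haD hbC hbD haC (by linear_combination h1), sub_self]
  · intro hne h₀ h₁ h₂
    have eC := ArchInt.span_sup_span_inf_ker (a := va) hbC
    have eD := ArchInt.span_sup_span_inf_ker (a := va) hbD
    -- ψ(φ(b)a - φ(a)b) = -φ(ψ(b)a - ψ(a)b), so if the line ⟨A,B⟩ ∩ C lay in D, then ⟨A,B⟩ ∩ D would
    -- lie in C and the two would coincide.
    have hl : ψ (φ vb • va - φ va • vb) ≠ 0 := by
      intro h0
      apply hne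
      rw [map_sub, map_smul, map_smul, smul_eq_mul, smul_eq_mul] at h0
      have hφ0 : φ (ψ vb • va - ψ va • vb) = 0 := by
        rw [map_sub, map_smul, map_smul, smul_eq_mul, smul_eq_mul]
        linear_combination -h0
      apply le_antisymm
      · refine le_inf inf_le_left ?_
        rw [eC, Submodule.span_singleton_le_iff_mem, LinearMap.mem_ker, map_sub, map_smul,
          map_smul, smul_eq_mul, smul_eq_mul]
        exact h0
      · refine le_inf inf_le_left ?_
        rw [eD, Submodule.span_singleton_le_iff_mem]
        exact hφ0
    have hl' : φ (ψ vb • va - ψ va • vb) ≠ 0 := by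
      intro h0
      apply hl
      rw [map_sub, map_smul, map_smul, smul_eq_mul, smul_eq_mul] at h0 ⊢
      linear_combination -h0
    have hd : Disjoint (LinearMap.ker φ ⊓ LinearMap.ker ψ)
        ((Submodule.span ℂ {va} ⊔ Submodule.span ℂ {vb}) ⊓ LinearMap.ker φ) := by
      rw [eC]
      exact (ArchInt.isCompl_ker_span_singleton hl).disjoint.mono_left inf_le_right
    have hs : (LinearMap.ker φ ⊓ LinearMap.ker ψ)
        ⊔ ((Submodule.span ℂ {va} ⊔ Submodule.span ℂ {vb}) ⊓ LinearMap.ker φ)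
        = LinearMap.ker φ := by
      -- Modular law: the line lies in ker φ and is complementary to ker ψ.
      rw [inf_sup_assoc_of_le (LinearMap.ker ψ) (inf_le_right), eC,
        (ArchInt.isCompl_ker_span_singleton hl).sup_eq_top, inf_top_eq]
    obtain ⟨h, hh⟩ := ArchInt.existsUnique_isOrthogonalSum hd hs h₀ h₁
    refine ⟨h, hh, ArchInt.exists_isOrientedGeodesic hn hC ?_ h h₂, fun γ hγ => ?_⟩
    · rw [eD]
      exact ArchInt.isCompl_ker_span_singleton hl'
    obtain ⟨g, i₀, hγt, hmC, hmW⟩ := hγ.exists_spike hn hC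
    -- Coordinate i₀ in the frame g is another equation of C, and replaces φ in the logarithms at
    -- the end.
    let χ : Module.Dual ℂ (Fin n → ℂ) :=
      LinearMap.proj i₀ ∘ₗ Matrix.toLin' ((g⁻¹ : ArchInt.G n) : ArchInt.Mat n)
    have hχ : LinearMap.ker φ = LinearMap.ker χ := by
      ext v
      exact hmC v
    have hcoord : ∀ {v : Fin n → ℂ}, v ∈ Submodule.span ℂ {va} ⊔ Submodule.span ℂ {vb} →
        ψ v ≠ 0 → ∃ i, i ≠ i₀ ∧ (((g⁻¹ : ArchInt.G n) : ArchInt.Mat n) *ᵥ v) i ≠ 0 :=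
      fun {v} hv hψ => by
        by_contra! hall
        exact hψ ((hmW v).2 hall).2
    have hwa : (((g⁻¹ : ArchInt.G n) : ArchInt.Mat n) *ᵥ va) i₀ ≠ 0 := mt (hmC va).2 haC
    have hwb : (((g⁻¹ : ArchInt.G n) : ArchInt.Mat n) *ᵥ vb) i₀ ≠ 0 := mt (hmC vb).2 hbC
    have hwa' := hcoord (Submodule.mem_sup_left (Submodule.mem_span_singleton_self va)) haD
    have hwb' := hcoord (Submodule.mem_sup_right (Submodule.mem_span_singleton_self vb)) hbD
    have hga := ArchInt.isGate_geod_spike_iff hn hγt hwa hwa'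
    have hgb := ArchInt.isGate_geod_spike_iff hn hγt hwb hwb'
    simp only [hga, hgb, existsUnique_eq, true_and]
    rintro x y rfl rfl
    -- ψ(b)a - ψ(a)b lies on the end line ⟨A,B⟩ ∩ D of γ, whose points have zero coordinates off i₀.
    have hprop : ∀ i, i ≠ i₀ → ψ vb * (((g⁻¹ : ArchInt.G n) : ArchInt.Mat n) *ᵥ va) i
        = ψ va * (((g⁻¹ : ArchInt.G n) : ArchInt.Mat n) *ᵥ vb) i := by
      intro i hi
      have hmem : ψ vb • va - ψ va • vb ∈
          (Submodule.span ℂ {va} ⊔ Submodule.span ℂ {vb}) ⊓ LinearMap.ker ψ := by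
        rw [eD]
        exact Submodule.mem_span_singleton_self _
      have h1 := (hmW _).1 hmem i hi
      rw [Matrix.mulVec_sub, Matrix.mulVec_smul, Matrix.mulVec_smul] at h1
      exact sub_eq_zero.1 h1
    rw [ArchInt.distor_geod_spike hn hγt,
      ArchInt.gateTime_sub_gateTime hn hwa hwb hwa' hwb' haD hbD hprop,
      ArchInt.log_norm_sq_sub_eq_of_ker_eq hχ haC hbC]
    rfl
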